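/- **Setting.** Fix $T>0$, $S_0\in\mathbb R$, $\sigma\ge 0$, $\gamma\ge 0$, $\lambda>0$, a continuous function $b:[0,T]\to\mathbb R$, and a standard Brownian motion $W$ with respect to a filtration $(\mathcal F_t)_{t\ge0}$ on a probability space $(\Omega,\mathcal F,\mathbb P)$ (so $W$ is adapted and $W(t)-W(s)$ is independent of $\mathcal F_s$ for $s\le t$). Put $S^0(t)=S_0+\sigma W(t)+\int_0^t b(s)\,ds$. For $x\in\mathbb R$, $\mathscr X(x,T)$ is the class of real-valued adapted processes $X=(X(t))_{t\in[0,T]}$ with $X(0)=x$ and $X(T)=0$, for which there are a constant $c\ge 0$ with $|X(t,\omega)|\le c$ for all $t,\omega$, and a progressively measurable process $\dot X$ such that, for all $\omega\in\Omega$, $\int_0^T\dot X(t,\omega)^2\,dt<\infty$ and $X(t,\omega)=X(0,\omega)+\int_0^t\dot X(s,\omega)\,ds$ for $t\in[0,T]$. $\mathscr X_{\det}(x,T)$ is the subclass of those $X$ that do not depend on $\omega$. For $n\in\mathbb N$ and admissible strategies $X_1,\dots,X_n$, write $\boldsymbol X_{-i}=\{X_1,\dots,X_{i-1},X_{i+1},\dots,X_n\}$.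 The revenues of player $i$ are $$\mathscr R(X_i|\boldsymbol X_{-i})=-\int_0^T\dot X_i(t)\Big(S^0(t)+\gamma\sum_{j=1}^n(X_j(t)-X_j(0))+\lambda\sum_{j=1}^n\dot X_j(t)\Big)\,dt.$$ Let $u_\alpha(r)=\frac1\alpha(1-e^{-\alpha r})$ for $\alpha>0$ and $u_0(r)=r$. Expected utilities are taken in $[-\infty,\infty]$, with value $-\infty$ if the negative part has infinite expectation. Given $x_1,\dots,x_n\in\mathbb R$ and $\alpha_1,\dots,\alpha_n\ge0$: * a *Nash equilibrium for mean-variance optimization* is a collection of $X_i^*\in\mathscr X_{\det}(x_i,T)$, $i=1,\dots,n$, such that, for each $i$, $X_i^*$ maximizes $\mathbb E[\mathscr R(X|\boldsymbol X^*_{-i})]-\frac{\alpha_i}2\operatorname{var}(\mathscr R(X|\boldsymbol X^*_{-i}))$ over all $X\in\mathscr X_{\det}(x_i,T)$; * a *Nash equilibrium for CARA utility maximization* is a collection of $X_i^*\in\mathscr X(x_i,T)$, $i=1,\dots,n$, such that, for each $i$, $X_i^*$ maximizes $\mathbb E[u_{\alpha_i}(\mathscr R(X|\boldsymbol X^*_{-i}))]$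 over all (adapted, possibly random) $X\in\mathscr X(x_i,T)$. **Statement.** For all $n\in\mathbb N$, $\alpha_1,\dots,\alpha_n\ge0$ and $x_1,\dots,x_n\in\mathbb R$, there is a unique Nash equilibrium $X_1^*,\dots,X_n^*$ for mean-variance optimization. It is given by the unique solution in $C^2[0,T]$ of $$\alpha_i\sigma^2X_i(t)-2\lambda\ddot X_i(t)=b(t)+\gamma\sum_{j\ne i}\dot X_j(t)+\lambda\sum_{j\ne i}\ddot X_j(t),\qquad X_i(0)=x_i,\quad X_i(T)=0,\qquad i=1,\dots,n.$$ This collection $X_1^*,\dots,X_n^*$ is also a Nash equilibrium for CARA utility maximization. -/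

import Mathlib

open MeasureTheory ProbabilityTheory Set
open scoped NNReal ENNReal

noncomputable section

namespace MarketImpact

variable {Ω : Type*} [mΩ : MeasurableSpace Ω] {n : ℕ}

/-- The deterministic data of the linear Almgren--Chriss market on the time interval `[0, T]`. -/
structure Market where
  /-- time horizon -/
  T : ℝ
  /-- initial price -/
  S₀ : ℝ
  /-- volatility -/
  σ : ℝ
  /-- permanent impact -/
  γ : ℝ
  /-- temporary impact -/
  lam : ℝ
  /-- deterministic drift -/
  b : ℝ → ℝ
  T_pos : 0 < T
  σ_nonneg : 0 ≤ σ
  γ_nonneg : 0 ≤ γ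
  lam_pos : 0 < lam
  b_cont : ContinuousOn b (Icc 0 T)

/-- `W` is a standard Brownian motion with respect to the filtration `F`. -/
structure IsFilteredBrownian (F : Filtration ℝ≥0 mΩ) (P : Measure Ω) (W : ℝ≥0 → Ω → ℝ) :
    Prop where
  brownian : IsBrownianReal W P
  adapted : Adapted F W
  indep : ∀ s t : ℝ≥0, s ≤ t →
    Indep (MeasurableSpace.comap (fun ω => W t ω - W s ω) inferInstance) (F s) P

/-- `X` belongs to the class of admissible strategies `𝒳(x, T)`. A process is a function of
`t : ℝ`; only its values for `t ∈ [0, T]` matter. -/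
structure Admissible (F : Filtration ℝ≥0 mΩ) (T x : ℝ) (X : ℝ → Ω → ℝ) : Prop where
  initial : ∀ ω, X 0 ω = x
  liquidation : ∀ ω, X T ω = 0
  adapted : ∀ t : ℝ≥0, (t : ℝ) ≤ T → Measurable[F t] (X t)
  absCont : ∃ V : ℝ → Ω → ℝ, IsProgressive F (fun (t : ℝ≥0) ω => V t ω) ∧
    ∀ ω, IntervalIntegrable (fun t => V t ω ^ 2) volume 0 T ∧
      ∀ t ∈ Icc 0 T, X t ω = X 0 ω + ∫ s in (0 : ℝ)..t, V s ω
  bounded : ∃ c : ℝ, 0 ≤ c ∧ ∀ t ∈ Icc 0 T, ∀ ω, |X t ω| ≤ c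

/-- `X` belongs to the class `𝒳_det(x, T)` of admissible strategies not depending on `ω`. -/
def AdmissibleDet (F : Filtration ℝ≥0 mΩ) (T x : ℝ) (X : ℝ → Ω → ℝ) : Prop :=
  Admissible F T x X ∧ ∀ t ∈ Icc 0 T, ∀ ω ω' : Ω, X t ω = X t ω'

/-- The trading rate `Ẋ(t, ω)`. For an admissible `X` and every `ω`, it agrees for almost every
`t ∈ [0, T]` with any density of the absolutely continuous path `X(·, ω)`. -/
def rate (X : ℝ → Ω → ℝ) (t : ℝ) (ω : Ω) : ℝ := deriv (fun s => X s ω) t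

/-- The unaffected price process `S⁰`. -/
def unaffectedPrice (M : Market) (W : ℝ≥0 → Ω → ℝ) (t : ℝ) (ω : Ω) : ℝ :=
  M.S₀ + M.σ * W t.toNNReal ω + ∫ s in (0 : ℝ)..t, M.b s

/-- The price process affected by the strategies of all players. -/
def price (M : Market) (W : ℝ≥0 → Ω → ℝ) (X : Fin n → ℝ → Ω → ℝ) (t : ℝ) (ω : Ω) : ℝ :=
  unaffectedPrice M W t ω + M.γ * ∑ j, (X j t ω - X j 0 ω) + M.lam * ∑ j, rate (X j) t ω

/-- The revenues of player `i` when he uses `Y` and every player `j ≠ i` uses `X j`. -/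
def revenues (M : Market) (W : ℝ≥0 → Ω → ℝ) (X : Fin n → ℝ → Ω → ℝ) (i : Fin n)
    (Y : ℝ → Ω → ℝ) (ω : Ω) : ℝ :=
  -∫ t in (0 : ℝ)..M.T, rate Y t ω * price M W (Function.update X i Y) t ω

/-- The CARA utility function with absolute risk aversion `α`. -/
def caraUtility (α x : ℝ) : ℝ := if α = 0 then x else (1 / α) * (1 - Real.exp (-α * x))

/-- The expectation as an extended real number, `𝔼[f⁺] - 𝔼[f⁻]`, with value `-∞` whenever
`𝔼[f⁻] = ∞`. It is the usual expectation if `f` is integrable. -/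
def extExpectation (P : Measure Ω) (f : Ω → ℝ) : EReal :=
  ((∫⁻ ω, ENNReal.ofReal (f ω) ∂P : ℝ≥0∞) : EReal)
    - ((∫⁻ ω, ENNReal.ofReal (-f ω) ∂P : ℝ≥0∞) : EReal)

/-- The mean-variance functional with risk aversion `α`. -/
def meanVariance (P : Measure Ω) (α : ℝ) (R : Ω → ℝ) : ℝ :=
  (∫ ω, R ω ∂P) - α / 2 * variance R P

/-- Nash equilibrium for mean-variance optimization, within deterministic strategies. -/
def IsMeanVarianceNash (M : Market) (F : Filtration ℝ≥0 mΩ) (P : Measure Ω) (W : ℝ≥0 → Ω → ℝ)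
    (α x : Fin n → ℝ) (X : Fin n → ℝ → Ω → ℝ) : Prop :=
  ∀ i, AdmissibleDet F M.T (x i) (X i) ∧
    ∀ Y : ℝ → Ω → ℝ, AdmissibleDet F M.T (x i) Y →
      meanVariance P (α i) (revenues M W X i Y) ≤ meanVariance P (α i) (revenues M W X i (X i))

/-- Nash equilibrium for CARA utility maximization, within all admissible strategies. -/
def IsCaraNash (M : Market) (F : Filtration ℝ≥0 mΩ) (P : Measure Ω) (W : ℝ≥0 → Ω → ℝ)
    (α x : Fin n → ℝ) (X : Fin n → ℝ → Ω → ℝ) : Prop :=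
  ∀ i, Admissible F M.T (x i) (X i) ∧
    ∀ Y : ℝ → Ω → ℝ, Admissible F M.T (x i) Y →
      extExpectation P (fun ω => caraUtility (α i) (revenues M W X i Y ω)) ≤
        extExpectation P (fun ω => caraUtility (α i) (revenues M W X i (X i) ω))

/-- `X` is a twice continuously differentiable solution on `[0, T]` of the system
`αᵢ σ² Xᵢ - 2 λ Xᵢ'' = b + γ ∑_{j ≠ i} Xⱼ' + λ ∑_{j ≠ i} Xⱼ''` with `Xᵢ(0) = xᵢ`, `Xᵢ(T) = 0`.
At the end points of `[0, T]` the derivatives are one-sided. -/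
def SolvesBVP (M : Market) (α x : Fin n → ℝ) (X : Fin n → ℝ → ℝ) : Prop :=
  (∀ i, ContDiffOn ℝ 2 (X i) (Icc 0 M.T) ∧ X i 0 = x i ∧ X i M.T = 0) ∧
  ∀ i, ∀ t ∈ Icc 0 M.T,
    α i * M.σ ^ 2 * X i t - 2 * M.lam * iteratedDerivWithin 2 (X i) (Icc 0 M.T) t =
      M.b t + M.γ * ∑ j ∈ Finset.univ.erase i, derivWithin (X j) (Icc 0 M.T) t
        + M.lam * ∑ j ∈ Finset.univ.erase i, iteratedDerivWithin 2 (X j) (Icc 0 M.T) t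

end MarketImpact

end

/-! When the opponents are deterministic, the revenues of a strategy `Z` starting at x are,
pathwise, σ∫Z dW + J(Z) - γx²/2 + (ασ²/2)∫Z² dt, where J is a deterministic quadratic functional of
the path (`pathObjective` with weight a = ασ², see `revenues_eq`). Permanent impact of the player's
own trades contributes only a boundary term, and ∫Z dW is defined pathwise by parts.

Both optimization problems reduce to maximizing J. For deterministic `Z` the integral ∫Z dW is
centred with variance ∫Z² dt, so the last term cancels against the variance penalty
(`meanVariance_revenues`). For CARA utility the same term completes exp(-ασ∫Z dW) to a stochastic
exponential, which has expectation one because `Z` is bounded; replacing J(Z) by its maximum in each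
scenario then bounds the expected utility (`extExpectation_caraUtility`).

J is concave on paths with fixed end points, so maximality is equivalent to a vanishing first
variation, and the equilibria are the solutions of a weak Euler–Lagrange system. Testing the
difference of two solutions with itself and summing over the players cancels the permanent impact
and leaves a sum of nonnegative terms (`WeakEulerLagrange.eqOn`). This uniqueness holds among
Sobolev paths, so no regularity theory is needed: once a classical solution exists, every
equilibrium coincides with it. Existence follows by shooting, where uniqueness makes a linear
endomorphism of a finite-dimensional space injective, hence surjective (`exists_solvesBVP`). -/

namespace MarketImpact

/-! ### Sobolev paths on `[0, T]`. -/

/-- Lebesgue measure on the trading interval. -/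
noncomputable abbrev timeMeasure (T : ℝ) : Measure ℝ := volume.restrict (Ioc 0 T)

/-- Absolutely continuous paths on `[0, T]` with square-integrable derivative. -/
structure SobolevPath (T : ℝ) (y : ℝ → ℝ) : Prop where
  ac : AbsolutelyContinuousOnInterval y 0 T
  memLp : MemLp (deriv y) 2 (timeMeasure T)

lemma absolutelyContinuousOnInterval_congr {f g : ℝ → ℝ} {a b : ℝ} (h : EqOn f g (uIcc a b))
    (hf : AbsolutelyContinuousOnInterval f a b) : AbsolutelyContinuousOnInterval g a b := by
  rw [absolutelyContinuousOnInterval_iff] at hf ⊢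
  intro ε hε
  obtain ⟨δ, hδ, H⟩ := hf ε hε
  refine ⟨δ, hδ, fun E hE hlt => ?_⟩
  have := H E hE hlt
  rwa [Finset.sum_congr rfl fun i hi => by rw [h (hE.1 i hi).1, h (hE.1 i hi).2]] at this

/-- At interior points the two-sided `deriv` does not see the arbitrary values of a path outside
`[0, T]`; dropping the end point costs a null set. -/
lemma ae_timeMeasure_mem_Ioo (T : ℝ) : ∀ᵐ t ∂(timeMeasure T), t ∈ Ioo 0 T := by
  have h : ∀ᵐ t ∂(timeMeasure T), t ≠ T := by
    refine ae_restrict_of_ae ?_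
    simp [ae_iff, measure_singleton]
  filter_upwards [h, ae_restrict_mem measurableSet_Ioc] with t h1 h2
  exact ⟨h2.1, lt_of_le_of_ne h2.2 h1⟩

lemma ae_differentiableAt_of_ac {T : ℝ} (hT : 0 < T) {y : ℝ → ℝ}
    (hy : AbsolutelyContinuousOnInterval y 0 T) :
    ∀ᵐ t ∂(timeMeasure T), DifferentiableAt ℝ y t := by
  filter_upwards [ae_restrict_of_ae hy.ae_differentiableAt, ae_timeMeasure_mem_Ioo T] with t h1 h2
  exact h1 (by rw [uIcc_of_le hT.le]; exact ⟨h2.1.le, h2.2.le⟩)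

lemma integral_timeMeasure {T : ℝ} (hT : 0 < T) (f : ℝ → ℝ) :
    ∫ t, f t ∂(timeMeasure T) = ∫ t in (0 : ℝ)..T, f t :=
  (intervalIntegral.integral_of_le hT.le).symm

lemma memLp_of_continuousOn {T : ℝ} {f : ℝ → ℝ} (hf : ContinuousOn f (Icc 0 T)) (p : ℝ≥0∞) :
    MemLp f p (timeMeasure T) := by
  obtain ⟨C, hC⟩ := isCompact_Icc.exists_bound_of_continuousOn hf
  refine MemLp.of_bound
    ((hf.mono Ioc_subset_Icc_self).aestronglyMeasurable measurableSet_Ioc) C ?_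
  filter_upwards [ae_restrict_mem measurableSet_Ioc] with t ht
  exact hC t (Ioc_subset_Icc_self ht)

namespace SobolevPath

variable {T : ℝ} {y z : ℝ → ℝ}

lemma continuousOn (hT : 0 < T) (hy : SobolevPath T y) : ContinuousOn y (Icc 0 T) := by
  simpa [uIcc_of_le hT.le] using hy.ac.continuousOn

lemma memLp_self (hT : 0 < T) (hy : SobolevPath T y) : MemLp y 2 (timeMeasure T) :=
  memLp_of_continuousOn (hy.continuousOn hT) 2

lemma ae_differentiableAt (hT : 0 < T) (hy : SobolevPath T y) :
    ∀ᵐ t ∂(timeMeasure T), DifferentiableAt ℝ y t :=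
  ae_differentiableAt_of_ac hT hy.ac

lemma deriv_add_const_mul (hT : 0 < T) (hy : SobolevPath T y) (hz : SobolevPath T z) (c : ℝ) :
    deriv (fun t => y t + c * z t) =ᵐ[timeMeasure T] fun t => deriv y t + c * deriv z t := by
  filter_upwards [hy.ae_differentiableAt hT, hz.ae_differentiableAt hT] with t h1 h2
  exact (h1.hasDerivAt.add (h2.hasDerivAt.const_mul c)).deriv

lemma add_const_mul (hT : 0 < T) (hy : SobolevPath T y) (hz : SobolevPath T z) (c : ℝ) :
    SobolevPath T (fun t => y t + c * z t) where
  ac := hy.ac.fun_add (hz.ac.const_mul c)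
  memLp := (memLp_congr_ae (hy.deriv_add_const_mul hT hz c)).2
    (hy.memLp.add (hz.memLp.const_mul c))

lemma const (T c : ℝ) : SobolevPath T (fun _ => c) where
  ac := by
    rw [absolutelyContinuousOnInterval_iff]
    intro ε hε
    exact ⟨1, one_pos, fun E _ _ => by simpa using hε⟩
  memLp := by simp

lemma sum (hT : 0 < T) {ι : Type*} (s : Finset ι) {y : ι → ℝ → ℝ}
    (hy : ∀ i, SobolevPath T (y i)) :
    SobolevPath T (fun t => ∑ i ∈ s, y i t) ∧
      deriv (fun t => ∑ i ∈ s, y i t) =ᵐ[timeMeasure T] fun t => ∑ i ∈ s, deriv (y i) t := by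
  classical
  induction s using Finset.induction_on with
  | empty => simpa using const T 0
  | insert a s ha ih =>
    simp only [Finset.sum_insert ha]
    constructor
    · simpa using (hy a).add_const_mul hT ih.1 1
    · have h := (hy a).deriv_add_const_mul hT ih.1 1
      simp only [one_mul] at h
      filter_upwards [h, ih.2] with t h1 h2
      rw [h1, h2]

lemma integral_deriv (hT : 0 < T) (hy : SobolevPath T y) {t : ℝ} (ht : t ∈ Icc 0 T) :
    y t = y 0 + ∫ s in (0 : ℝ)..t, deriv y s := by
  rw [(hy.ac.mono (by rw [uIcc_of_le ht.1, uIcc_of_le hT.le]; exact Icc_subset_Icc_right ht.2)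
    ).integral_deriv_eq_sub]
  ring

lemma integral_deriv_mul_self (hT : 0 < T) (hy : SobolevPath T y) :
    ∫ t, deriv y t * y t ∂(timeMeasure T) = (y T ^ 2 - y 0 ^ 2) / 2 := by
  rw [integral_timeMeasure hT]
  have h := AbsolutelyContinuousOnInterval.integral_mul_deriv_eq_deriv_mul hy.ac hy.ac
  simp_rw [mul_comm (y _) (deriv y _)] at h
  linarith

lemma integral_deriv_mul (hT : 0 < T) (hy : SobolevPath T y)
    (hz : AbsolutelyContinuousOnInterval z 0 T) :
    ∫ t, deriv y t * z t ∂(timeMeasure T) =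
      y T * z T - y 0 * z 0 - ∫ t, y t * deriv z t ∂(timeMeasure T) := by
  rw [integral_timeMeasure hT, integral_timeMeasure hT]
  have h := AbsolutelyContinuousOnInterval.integral_mul_deriv_eq_deriv_mul hz hy.ac
  simp_rw [mul_comm (z _) (deriv y _), mul_comm (deriv z _)] at h
  linarith

lemma eqOn_const_of_deriv_ae_eq_zero (hT : 0 < T) (hy : SobolevPath T y)
    (h : deriv y =ᵐ[timeMeasure T] 0) {t : ℝ} (ht : t ∈ Icc 0 T) : y t = y 0 := by
  rw [hy.integral_deriv hT ht, intervalIntegral.integral_of_le ht.1]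
  have : ∫ s in Ioc 0 t, deriv y s = ∫ s in Ioc 0 t, (0 : ℝ) :=
    integral_congr_ae (ae_restrict_of_ae_restrict_of_subset (Ioc_subset_Ioc_right ht.2) h)
  rw [this]
  simp

/-- Lebesgue differentiation. This links the density in the definition of admissibility with
`deriv`, hence with `rate`. -/
lemma of_eq_integral (hT : 0 < T) {v : ℝ → ℝ} {c : ℝ} (hv : MemLp v 2 (timeMeasure T))
    (hy : ∀ t ∈ Icc 0 T, y t = c + ∫ s in (0 : ℝ)..t, v s) :
    SobolevPath T y ∧ deriv y =ᵐ[timeMeasure T] v := by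
  have hvi : IntervalIntegrable v volume 0 T :=
    (intervalIntegrable_iff_integrableOn_Ioc_of_le hT.le).2 (hv.integrable (by norm_num))
  have hd : deriv y =ᵐ[timeMeasure T] v := by
    filter_upwards [ae_restrict_of_ae hvi.ae_hasDerivAt_integral, ae_timeMeasure_mem_Ioo T]
      with t h1 h2
    have h3 : HasDerivAt (fun x => ∫ s in (0 : ℝ)..x, v s) (v t) t :=
      h1 (by rw [uIcc_of_le hT.le]; exact ⟨h2.1.le, h2.2.le⟩) 0 (by simp)
    have h4 : HasDerivAt y (v t) t := by
      refine (h3.const_add c).congr_of_eventuallyEq ?_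
      filter_upwards [Ioo_mem_nhds h2.1 h2.2] with s hs
      exact hy s ⟨hs.1.le, hs.2.le⟩
    exact h4.deriv
  refine ⟨⟨?_, (memLp_congr_ae hd).2 hv⟩, hd⟩
  refine absolutelyContinuousOnInterval_congr (f := fun t => c + ∫ s in (0 : ℝ)..t, v s) ?_
    ((const T c).ac.fun_add (hvi.absolutelyContinuousOnInterval_intervalIntegral (by simp)))
  intro t ht
  rw [uIcc_of_le hT.le] at ht
  exact (hy t ht).symm

/-- Paths which are continuous on `[0, T]` and continuously differentiable inside. -/
lemma of_hasDerivAt (hT : 0 < T) {v : ℝ → ℝ} (hv : ContinuousOn v (Icc 0 T))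
    (hyc : ContinuousOn y (Icc 0 T)) (hy : ∀ t ∈ Ioo 0 T, HasDerivAt y (v t) t) :
    SobolevPath T y := by
  refine (of_eq_integral hT (memLp_of_continuousOn hv 2) (c := y 0) fun t ht => ?_).1
  have hsub : Icc 0 t ⊆ Icc 0 T := Icc_subset_Icc_right ht.2
  rw [intervalIntegral.integral_eq_sub_of_hasDerivAt_of_le ht.1 (hyc.mono hsub)
    (fun s hs => hy s ⟨hs.1, hs.2.trans_le ht.2⟩) ((hv.mono hsub).intervalIntegrable_of_Icc ht.1)]
  ring

end SobolevPath

/-! ### Paths of admissible strategies. -/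

variable {Ω : Type*} [mΩ : MeasurableSpace Ω] {F : Filtration ℝ≥0 mΩ} {T x : ℝ}

lemma Admissible.sobolevPath (hT : 0 < T) {X : ℝ → Ω → ℝ} (hX : Admissible F T x X) (ω : Ω) :
    SobolevPath T (fun t => X t ω) := by
  obtain ⟨V, hV, hVX⟩ := hX.absCont
  obtain ⟨hV2, hint⟩ := hVX ω
  have hmeas : AEStronglyMeasurable (fun t => V t ω) (timeMeasure T) := by
    have h1 := (hV T.toNNReal).comp (measurable_prodMk_right (mβ := F T.toNNReal) (y := ω))
    -- Progressive measurability speaks about the time set `Iic T`; truncating time at `T` lands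
    -- there and changes nothing on `(0, T]`.
    have h2 : Measurable (fun t : ℝ => (⟨min t.toNNReal T.toNNReal,
        mem_Iic.2 (min_le_right _ _)⟩ : Iic T.toNNReal)) :=
      Measurable.subtype_mk (measurable_real_toNNReal.min measurable_const)
    refine (h1.comp h2).aestronglyMeasurable.congr ?_
    filter_upwards [ae_restrict_mem measurableSet_Ioc] with t ht
    simp [min_eq_left (Real.toNNReal_le_toNNReal ht.2), ht.1.le]
  refine (SobolevPath.of_eq_integral hT (v := fun t => V t ω) (c := X 0 ω) ?_ hint).1
  rw [memLp_two_iff_integrable_sq hmeas]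
  exact (intervalIntegrable_iff_integrableOn_Ioc_of_le hT.le).1 hV2

lemma SobolevPath.admissibleDet (F : Filtration ℝ≥0 mΩ) (hT : 0 < T) {y : ℝ → ℝ}
    (hy : SobolevPath T y) (h0 : y 0 = x) (h1 : y T = 0) :
    AdmissibleDet F T x (fun t (_ : Ω) => y t) := by
  refine ⟨⟨fun _ => h0, fun _ => h1, fun _ _ => measurable_const, ?_, ?_⟩, fun _ _ _ _ => rfl⟩
  · refine ⟨fun t _ => deriv y t, fun i => ?_, fun ω => ⟨?_, fun t ht => hy.integral_deriv hT ht⟩⟩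
    · exact (measurable_deriv y).comp (measurable_subtype_coe.comp
        (measurable_subtype_coe.comp measurable_fst))
    · exact (intervalIntegrable_iff_integrableOn_Ioc_of_le hT.le).2 hy.memLp.integrable_sq
  · obtain ⟨C, hC⟩ := isCompact_Icc.exists_bound_of_continuousOn (hy.continuousOn hT)
    exact ⟨max C 0, le_max_right _ _, fun t ht _ => (hC t ht).trans (le_max_left _ _)⟩

/-! ### Calculus of variations for a single player. -/

/-- The deterministic part of the impacted price which player `i` does not control. -/
noncomputable def exogenousPrice {n : ℕ} (M : Market) (y : Fin n → ℝ → ℝ) (i : Fin n) (t : ℝ) :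
    ℝ :=
  M.S₀ + (∫ s in (0 : ℝ)..t, M.b s) + M.γ * ∑ j ∈ Finset.univ.erase i, (y j t - y j 0)
    + M.lam * ∑ j ∈ Finset.univ.erase i, deriv (y j) t

/-- The mean-variance functional of a path, up to a term depending on its end points only. -/
noncomputable def pathObjective (T lam a : ℝ) (p y : ℝ → ℝ) : ℝ :=
  -∫ t, (deriv y t * (p t + lam * deriv y t) + a / 2 * y t ^ 2) ∂(timeMeasure T)

/-- The negative of the first variation of `pathObjective` at `y` in the direction `η`. -/
noncomputable def firstVariation (T lam a : ℝ) (p y η : ℝ → ℝ) : ℝ :=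
  ∫ t, (deriv η t * (p t + 2 * lam * deriv y t) + a * (y t * η t)) ∂(timeMeasure T)

section Variation

variable {T lam a : ℝ} {p y η : ℝ → ℝ}

lemma integrable_firstVariation (hT : 0 < T) (hp : MemLp p 2 (timeMeasure T))
    (hy : SobolevPath T y) (hη : SobolevPath T η) :
    Integrable (fun t => deriv η t * (p t + 2 * lam * deriv y t) + a * (y t * η t))
      (timeMeasure T) :=
  (hη.memLp.integrable_mul (hp.add (hy.memLp.const_mul (2 * lam)))).add
    (((hy.memLp_self hT).integrable_mul (hη.memLp_self hT)).const_mul a)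

lemma integrable_pathObjective (hT : 0 < T) (hp : MemLp p 2 (timeMeasure T))
    (hy : SobolevPath T y) :
    Integrable (fun t => deriv y t * (p t + lam * deriv y t) + a / 2 * y t ^ 2)
      (timeMeasure T) :=
  (hy.memLp.integrable_mul (hp.add (hy.memLp.const_mul lam))).add
    ((hy.memLp_self hT).integrable_sq.const_mul (a / 2))

/-- The functional is quadratic in the path, so the second-order expansion is exact. For nonnegative
`lam` and `a` the last integral is nonnegative, which is concavity. -/
lemma pathObjective_add_const_mul (hT : 0 < T) (hp : MemLp p 2 (timeMeasure T))
    (hy : SobolevPath T y) (hη : SobolevPath T η) (ε : ℝ) :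
    pathObjective T lam a p (fun t => y t + ε * η t) =
      pathObjective T lam a p y - ε * firstVariation T lam a p y η
        - ε ^ 2 * ∫ t, (lam * deriv η t ^ 2 + a / 2 * η t ^ 2) ∂(timeMeasure T) := by
  have hQ : Integrable (fun t => lam * deriv η t ^ 2 + a / 2 * η t ^ 2) (timeMeasure T) :=
    (hη.memLp.integrable_sq.const_mul lam).add ((hη.memLp_self hT).integrable_sq.const_mul (a / 2))
  have hD := integrable_firstVariation (lam := lam) (a := a) hT hp hy hη
  have hJ := integrable_pathObjective (lam := lam) (a := a) hT hp hy
  unfold pathObjective firstVariation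
  have hDQ := (hD.const_mul ε).add (hQ.const_mul (ε ^ 2))
  simp only [Pi.add_def] at hDQ
  rw [← integral_const_mul, ← integral_const_mul, sub_sub, ← integral_add (hD.const_mul ε)
    (hQ.const_mul _), ← neg_add', ← integral_add hJ hDQ]
  congr 1
  refine integral_congr_ae ?_
  filter_upwards [hy.deriv_add_const_mul hT hη ε] with t ht
  rw [ht]
  ring

lemma pathObjective_le_of_firstVariation_eq_zero (hT : 0 < T) (hlam : 0 ≤ lam) (ha : 0 ≤ a)
    (hp : MemLp p 2 (timeMeasure T)) (hy : SobolevPath T y)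
    (h : ∀ η, SobolevPath T η → η 0 = 0 → η T = 0 → firstVariation T lam a p y η = 0)
    {z : ℝ → ℝ} (hz : SobolevPath T z) (h0 : z 0 = y 0) (h1 : z T = y T) :
    pathObjective T lam a p z ≤ pathObjective T lam a p y := by
  have hη := hz.add_const_mul hT hy (-1)
  have key := pathObjective_add_const_mul (lam := lam) (a := a) hT hp hy hη 1
  rw [h _ hη (by simp [h0]) (by simp [h1])] at key
  have hz' : (fun t => y t + 1 * (z t + -1 * y t)) = z := by ext t; ring
  rw [hz'] at key
  have : 0 ≤ ∫ t, (lam * deriv (fun t => z t + -1 * y t) t ^ 2 + a / 2 * (z t + -1 * y t) ^ 2)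
      ∂(timeMeasure T) := integral_nonneg fun t => by positivity
  linarith

lemma firstVariation_eq_zero_of_isMax (hT : 0 < T) (hp : MemLp p 2 (timeMeasure T))
    (hy : SobolevPath T y) (hη : SobolevPath T η)
    (h : ∀ ε : ℝ, pathObjective T lam a p (fun t => y t + ε * η t) ≤ pathObjective T lam a p y) :
    firstVariation T lam a p y η = 0 := by
  set D := firstVariation T lam a p y η with hD
  set Q := ∫ t, (lam * deriv η t ^ 2 + a / 2 * η t ^ 2) ∂(timeMeasure T) with hQ
  have key : ∀ ε : ℝ, 0 ≤ ε * D + ε ^ 2 * Q := by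
    intro ε
    have := h ε
    rw [pathObjective_add_const_mul hT hp hy hη] at this
    linarith
  by_contra hne
  -- A small step against the sign of `D`: with `|Q| + 1 > Q`, the linear term beats the quadratic
  -- one.
  have h1 := key (-D / (|Q| + 1))
  have hpos : 0 < |Q| + 1 := by positivity
  have h2 : -D / (|Q| + 1) * D + (-D / (|Q| + 1)) ^ 2 * Q
      = -(D ^ 2 / (|Q| + 1) ^ 2) * (|Q| + 1 - Q) := by
    field_simp
    ring
  rw [h2] at h1
  have h3 : 0 < D ^ 2 / (|Q| + 1) ^ 2 := by positivity
  nlinarith [le_abs_self Q]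

end Variation

/-! ### The weak Euler–Lagrange system and its uniqueness. -/

/-- The weak Euler--Lagrange system of the game. -/
def WeakEulerLagrange {n : ℕ} (M : Market) (α : Fin n → ℝ) (y : Fin n → ℝ → ℝ) : Prop :=
  ∀ i η, SobolevPath M.T η → η 0 = 0 → η M.T = 0 →
    firstVariation M.T M.lam (α i * M.σ ^ 2) (exogenousPrice M y i) (y i) η = 0

lemma Market.continuousOn_integral_b (M : Market) :
    ContinuousOn (fun t => ∫ s in (0 : ℝ)..t, M.b s) (Icc 0 M.T) := by
  have h : IntegrableOn M.b (uIcc 0 M.T) := by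
    rw [uIcc_of_le M.T_pos.le]
    exact M.b_cont.integrableOn_Icc
  simpa [uIcc_of_le M.T_pos.le] using intervalIntegral.continuousOn_primitive_interval h

lemma memLp_exogenousPrice {n : ℕ} {M : Market} {y : Fin n → ℝ → ℝ}
    (hy : ∀ i, SobolevPath M.T (y i)) (i : Fin n) :
    MemLp (exogenousPrice M y i) 2 (timeMeasure M.T) := by
  have h1 : MemLp (fun t => M.S₀ + (∫ s in (0 : ℝ)..t, M.b s)
      + M.γ * ∑ j ∈ Finset.univ.erase i, (y j t - y j 0)) 2 (timeMeasure M.T) := by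
    refine memLp_of_continuousOn ?_ 2
    refine (continuousOn_const.add M.continuousOn_integral_b).add (continuousOn_const.mul ?_)
    exact continuousOn_finsetSum _ fun j _ =>
      ((hy j).continuousOn M.T_pos).sub continuousOn_const
  exact h1.add ((memLp_finsetSum _ fun j _ => (hy j).memLp).const_mul M.lam)

lemma sum_mul_sum_erase {n : ℕ} (u v : Fin n → ℝ) :
    ∑ i, u i * ∑ j ∈ Finset.univ.erase i, v j = (∑ i, u i) * (∑ i, v i) - ∑ i, u i * v i := by
  rw [Finset.sum_mul, ← Finset.sum_sub_distrib]
  refine Finset.sum_congr rfl fun i _ => ?_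
  rw [← Finset.add_sum_erase _ v (Finset.mem_univ i)]
  ring

/-- Energy estimate: weak solutions of the Euler--Lagrange system are determined by their values
at the end points. -/
lemma WeakEulerLagrange.eqOn {n : ℕ} {M : Market} {α : Fin n → ℝ} (hα : ∀ i, 0 ≤ α i)
    {y z : Fin n → ℝ → ℝ} (hy : ∀ i, SobolevPath M.T (y i)) (hz : ∀ i, SobolevPath M.T (z i))
    (hyw : WeakEulerLagrange M α y) (hzw : WeakEulerLagrange M α z)
    (h0 : ∀ i, y i 0 = z i 0) (h1 : ∀ i, y i M.T = z i M.T) (i : Fin n) :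
    EqOn (y i) (z i) (Icc 0 M.T) := by
  have hT := M.T_pos
  set d : Fin n → ℝ → ℝ := fun i t => y i t + -1 * z i t with hd
  have hdS : ∀ i, SobolevPath M.T (d i) := fun i => (hy i).add_const_mul hT (hz i) (-1)
  have hd0 : ∀ i, d i 0 = 0 := fun i => by simp [hd, h0]
  have hd1 : ∀ i, d i M.T = 0 := fun i => by simp [hd, h1]
  obtain ⟨hDS, hDd⟩ := SobolevPath.sum hT Finset.univ hdS
  have hderiv : ∀ᵐ t ∂(timeMeasure M.T), ∀ i, deriv (d i) t = deriv (y i) t - deriv (z i) t := by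
    refine ae_all_iff.2 fun i => ?_
    filter_upwards [(hy i).deriv_add_const_mul hT (hz i) (-1)] with t ht
    rw [ht]; ring
  have hI : ∀ i, Integrable (fun t => deriv (d i) t *
      (exogenousPrice M y i t + 2 * M.lam * deriv (y i) t)
        + α i * M.σ ^ 2 * (y i t * d i t)) (timeMeasure M.T) := fun i =>
    integrable_firstVariation hT (memLp_exogenousPrice hy i) (hy i) (hdS i)
  have hI' : ∀ i, Integrable (fun t => deriv (d i) t *
      (exogenousPrice M z i t + 2 * M.lam * deriv (z i) t)
        + α i * M.σ ^ 2 * (z i t * d i t)) (timeMeasure M.T) := fun i =>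
    integrable_firstVariation hT (memLp_exogenousPrice hz i) (hz i) (hdS i)
  -- Each difference `d i` vanishes at both ends, so it is a legitimate test function in both
  -- systems.
  have hzero : ∫ t, (∑ i, ((deriv (d i) t *
      (exogenousPrice M y i t + 2 * M.lam * deriv (y i) t)
        + α i * M.σ ^ 2 * (y i t * d i t)) - (deriv (d i) t *
      (exogenousPrice M z i t + 2 * M.lam * deriv (z i) t)
        + α i * M.σ ^ 2 * (z i t * d i t)))) ∂(timeMeasure M.T) = 0 := by
    refine (integral_finsetSum _ fun i _ => (hI i).sub (hI' i)).trans ?_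
    refine Finset.sum_eq_zero fun i _ => ?_
    have e1 := hyw i (d i) (hdS i) (hd0 i) (hd1 i)
    have e2 := hzw i (d i) (hdS i) (hd0 i) (hd1 i)
    unfold firstVariation at e1 e2
    refine (integral_sub (hI i) (hI' i)).trans ?_
    rw [e1, e2, sub_zero]
  -- Own temporary impact carries 2λ; the cross terms turn one λ Σ dᵢ'² into λ(Σ dᵢ')², so every λ
  -- term is a square. The γ terms are derivatives of squares.
  have hpt : (fun t => ∑ i, ((deriv (d i) t *
      (exogenousPrice M y i t + 2 * M.lam * deriv (y i) t)
        + α i * M.σ ^ 2 * (y i t * d i t)) - (deriv (d i) t *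
      (exogenousPrice M z i t + 2 * M.lam * deriv (z i) t)
        + α i * M.σ ^ 2 * (z i t * d i t)))) =ᵐ[timeMeasure M.T] fun t =>
      (M.γ * (deriv (fun t => ∑ i, d i t) t * ∑ i, d i t)
        - M.γ * ∑ i, deriv (d i) t * d i t)
      + (M.lam * deriv (fun t => ∑ i, d i t) t ^ 2 + M.lam * ∑ i, deriv (d i) t ^ 2
        + ∑ i, α i * M.σ ^ 2 * d i t ^ 2) := by
    filter_upwards [hderiv, hDd] with t ht hDt
    have e : ∀ i, ((deriv (d i) t *
      (exogenousPrice M y i t + 2 * M.lam * deriv (y i) t)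
        + α i * M.σ ^ 2 * (y i t * d i t)) - (deriv (d i) t *
      (exogenousPrice M z i t + 2 * M.lam * deriv (z i) t)
        + α i * M.σ ^ 2 * (z i t * d i t))) =
        M.γ * (deriv (d i) t * ∑ j ∈ Finset.univ.erase i, d j t)
        + M.lam * (deriv (d i) t * ∑ j ∈ Finset.univ.erase i, deriv (d j) t)
        + 2 * M.lam * deriv (d i) t ^ 2 + α i * M.σ ^ 2 * d i t ^ 2 := by
      intro i
      have s1 : ∑ j ∈ Finset.univ.erase i, d j t =
          ∑ j ∈ Finset.univ.erase i, (y j t - y j 0)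
            - ∑ j ∈ Finset.univ.erase i, (z j t - z j 0) := by
        rw [← Finset.sum_sub_distrib]
        refine Finset.sum_congr rfl fun j _ => ?_
        simp only [hd, h0]
        ring
      have s2 : ∑ j ∈ Finset.univ.erase i, deriv (d j) t =
          ∑ j ∈ Finset.univ.erase i, deriv (y j) t - ∑ j ∈ Finset.univ.erase i, deriv (z j) t := by
        rw [← Finset.sum_sub_distrib]
        exact Finset.sum_congr rfl fun j _ => ht j
      rw [s1, s2]
      have s3 : deriv (y i) t = deriv (d i) t + deriv (z i) t := by rw [ht i]; ring
      have s4 : y i t = d i t + z i t := by simp only [hd]; ring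
      unfold exogenousPrice
      rw [s3, s4]
      ring
    simp_rw [e]
    rw [Finset.sum_add_distrib, Finset.sum_add_distrib, Finset.sum_add_distrib, ← Finset.mul_sum,
      ← Finset.mul_sum, ← Finset.mul_sum, sum_mul_sum_erase, sum_mul_sum_erase, hDt]
    simp_rw [← sq]
    ring
  rw [integral_congr_ae hpt] at hzero
  have i1 : Integrable (fun t => M.γ * (deriv (fun t => ∑ i, d i t) t * ∑ i, d i t))
      (timeMeasure M.T) := (hDS.memLp.integrable_mul (hDS.memLp_self hT)).const_mul M.γ
  have i2 : Integrable (fun t => M.γ * ∑ i, deriv (d i) t * d i t) (timeMeasure M.T) :=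
    (integrable_finsetSum _ fun i _ =>
      (hdS i).memLp.integrable_mul ((hdS i).memLp_self hT)).const_mul M.γ
  have i3 : Integrable (fun t => M.lam * deriv (fun t => ∑ i, d i t) t ^ 2
      + M.lam * ∑ i, deriv (d i) t ^ 2 + ∑ i, α i * M.σ ^ 2 * d i t ^ 2) (timeMeasure M.T) :=
    ((hDS.memLp.integrable_sq.const_mul _).add ((integrable_finsetSum _ fun i _ =>
      (hdS i).memLp.integrable_sq).const_mul _)).add (integrable_finsetSum _ fun i _ =>
      ((hdS i).memLp_self hT).integrable_sq.const_mul _)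
  -- Total derivatives of paths vanishing at both ends integrate to zero.
  have z1 : ∫ t, M.γ * (deriv (fun t => ∑ i, d i t) t * ∑ i, d i t) ∂(timeMeasure M.T) = 0 := by
    rw [integral_const_mul, hDS.integral_deriv_mul_self hT]
    simp [hd0, hd1]
  have z2 : ∫ t, M.γ * ∑ i, deriv (d i) t * d i t ∂(timeMeasure M.T) = 0 := by
    rw [integral_const_mul]
    refine mul_eq_zero_of_right _ ((integral_finsetSum _ fun i _ =>
      (hdS i).memLp.integrable_mul ((hdS i).memLp_self hT)).trans
        (Finset.sum_eq_zero fun i _ => ?_))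
    simp only [Pi.mul_apply]
    rw [(hdS i).integral_deriv_mul_self hT, hd0, hd1]
    simp
  have i12 := i1.sub i2
  simp only [Pi.sub_def] at i12
  rw [integral_add i12 i3, integral_sub i1 i2, z1, z2, sub_zero, zero_add] at hzero
  have hlam := M.lam_pos
  have hnn : ∀ t, 0 ≤ M.lam * deriv (fun t => ∑ i, d i t) t ^ 2
      + M.lam * ∑ i, deriv (d i) t ^ 2 + ∑ i, α i * M.σ ^ 2 * d i t ^ 2 := fun t => by
    have : 0 ≤ ∑ i, α i * M.σ ^ 2 * d i t ^ 2 := Finset.sum_nonneg fun i _ => by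
      have := hα i; positivity
    positivity
  have hae := (integral_eq_zero_iff_of_nonneg hnn i3).1 hzero
  have hdi : deriv (d i) =ᵐ[timeMeasure M.T] 0 := by
    filter_upwards [hae] with t ht
    simp only [Pi.zero_apply] at ht ⊢
    have t1 : 0 ≤ ∑ i, α i * M.σ ^ 2 * d i t ^ 2 := Finset.sum_nonneg fun i _ => by
      have := hα i; positivity
    have t2 : 0 ≤ M.lam * deriv (fun t => ∑ i, d i t) t ^ 2 := by positivity
    have t3 : deriv (d i) t ^ 2 ≤ ∑ i, deriv (d i) t ^ 2 :=
      Finset.single_le_sum (f := fun i => deriv (d i) t ^ 2) (fun i _ => sq_nonneg _)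
        (Finset.mem_univ i)
    have t4 : M.lam * deriv (d i) t ^ 2 ≤ 0 := by
      have := mul_le_mul_of_nonneg_left t3 hlam.le
      linarith
    have t5 : deriv (d i) t ^ 2 ≤ 0 := nonpos_of_mul_nonpos_right t4 hlam
    exact pow_eq_zero_iff two_ne_zero |>.1 (le_antisymm t5 (sq_nonneg _))
  intro t ht
  have := (hdS i).eqOn_const_of_deriv_ae_eq_zero hT hdi ht
  rw [hd0] at this
  simp only [hd] at this
  linarith

/-! ### Classical solutions and the boundary value problem. -/

/-- Continuous extension of the drift to the real line. -/
noncomputable def Market.drift (M : Market) : ℝ → ℝ :=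
  IccExtend M.T_pos.le (fun t : Icc 0 M.T => M.b t)

lemma Market.continuous_drift (M : Market) : Continuous M.drift :=
  (continuousOn_iff_continuous_domRestrict.1 M.b_cont).Icc_extend'

lemma Market.drift_eq (M : Market) {t : ℝ} (ht : t ∈ Icc 0 M.T) : M.drift t = M.b t := by
  simp [Market.drift, IccExtend_of_mem _ _ ht]

lemma Market.hasDerivAt_integral_b (M : Market) {t : ℝ} (ht : t ∈ Ioo 0 M.T) :
    HasDerivAt (fun t => ∫ s in (0 : ℝ)..t, M.b s) (M.b t) t := by
  rw [← M.drift_eq ⟨ht.1.le, ht.2.le⟩]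
  refine (M.continuous_drift.integral_hasStrictDerivAt 0 t).hasDerivAt.congr_of_eventuallyEq ?_
  filter_upwards [Ioo_mem_nhds ht.1 ht.2] with s hs
  refine intervalIntegral.integral_congr fun r hr => ?_
  rw [uIcc_of_le hs.1.le] at hr
  exact (M.drift_eq ⟨hr.1, hr.2.trans hs.2.le⟩).symm

section Classical

variable {n : ℕ} {M : Market} {α : Fin n → ℝ} {y v w : Fin n → ℝ → ℝ}

/-- Classical solutions of the second order system are weak solutions of the Euler--Lagrange
system. -/
lemma weakEulerLagrange_of_classical
    (hy : ∀ i, ∀ t ∈ Icc 0 M.T, HasDerivWithinAt (y i) (v i t) (Icc 0 M.T) t)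
    (hv : ∀ i, ∀ t ∈ Icc 0 M.T, HasDerivWithinAt (v i) (w i t) (Icc 0 M.T) t)
    (h : ∀ i, ∀ t ∈ Icc 0 M.T, α i * M.σ ^ 2 * y i t - 2 * M.lam * w i t =
      M.b t + M.γ * ∑ j ∈ Finset.univ.erase i, v j t
        + M.lam * ∑ j ∈ Finset.univ.erase i, w j t) :
    (∀ i, SobolevPath M.T (y i)) ∧ WeakEulerLagrange M α y := by
  have hT := M.T_pos
  have hyc : ∀ i, ContinuousOn (y i) (Icc 0 M.T) := fun i t ht => (hy i t ht).continuousWithinAt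
  have hvc : ∀ i, ContinuousOn (v i) (Icc 0 M.T) := fun i t ht => (hv i t ht).continuousWithinAt
  have hyd : ∀ i, ∀ t ∈ Ioo 0 M.T, HasDerivAt (y i) (v i t) t := fun i t ht =>
    (hy i t ⟨ht.1.le, ht.2.le⟩).hasDerivAt (Icc_mem_nhds ht.1 ht.2)
  have hvd : ∀ i, ∀ t ∈ Ioo 0 M.T, HasDerivAt (v i) (w i t) t := fun i t ht =>
    (hv i t ⟨ht.1.le, ht.2.le⟩).hasDerivAt (Icc_mem_nhds ht.1 ht.2)
  have hS : ∀ i, SobolevPath M.T (y i) := fun i => .of_hasDerivAt hT (hvc i) (hyc i) (hyd i)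
  refine ⟨hS, fun i η hη h0 h1 => ?_⟩
  -- `q` is the momentum, the coefficient of η' in the first variation. The differential equation
  -- says exactly q' = αᵢσ²yᵢ, so the integrand becomes (ηq)'.
  set q : ℝ → ℝ := fun t => M.S₀ + (∫ s in (0 : ℝ)..t, M.b s)
    + M.γ * ∑ j ∈ Finset.univ.erase i, (y j t - y j 0)
    + M.lam * ∑ j ∈ Finset.univ.erase i, v j t + 2 * M.lam * v i t with hq
  have hqc : ContinuousOn q (Icc 0 M.T) := by
    refine (((continuousOn_const.add M.continuousOn_integral_b).add (continuousOn_const.mul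
      (continuousOn_finsetSum _ fun j _ => (hyc j).sub continuousOn_const))).add
      (continuousOn_const.mul (continuousOn_finsetSum _ fun j _ => hvc j))).add
      (continuousOn_const.mul (hvc i))
  have hqd : ∀ t ∈ Ioo 0 M.T, HasDerivAt q (α i * M.σ ^ 2 * y i t) t := by
    intro t ht
    have e := (((((M.hasDerivAt_integral_b ht).const_add M.S₀).add (.const_mul M.γ
      (.fun_sum (u := Finset.univ.erase i) fun j _ => (hyd j t ht).sub_const (y j 0)))).add
      (.const_mul M.lam (.fun_sum (u := Finset.univ.erase i) fun j _ => hvd j t ht))).add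
      ((hvd i t ht).const_mul (2 * M.lam)))
    have e2 := h i t ⟨ht.1.le, ht.2.le⟩
    convert! e using 1
    linarith
  have hqS : SobolevPath M.T q :=
    .of_hasDerivAt hT (continuousOn_const.mul (hyc i)) hqc hqd
  have hae : (fun t => deriv η t * (exogenousPrice M y i t + 2 * M.lam * deriv (y i) t)
      + α i * M.σ ^ 2 * (y i t * η t)) =ᵐ[timeMeasure M.T]
      fun t => deriv η t * q t + η t * deriv q t := by
    filter_upwards [ae_timeMeasure_mem_Ioo M.T] with t ht
    rw [(hqd t ht).deriv, (hyd i t ht).deriv]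
    have : ∑ j ∈ Finset.univ.erase i, deriv (y j) t = ∑ j ∈ Finset.univ.erase i, v j t :=
      Finset.sum_congr rfl fun j _ => (hyd j t ht).deriv
    unfold exogenousPrice
    rw [this, hq]
    ring
  unfold firstVariation
  rw [integral_congr_ae hae, integral_add (f := fun t => deriv η t * q t)
    (g := fun t => η t * deriv q t) (hη.memLp.integrable_mul (hqS.memLp_self hT))
    ((hη.memLp_self hT).integrable_mul hqS.memLp), hη.integral_deriv_mul hT hqS.ac, h0, h1]
  ring

lemma SolvesBVP.weakEulerLagrange {x : Fin n → ℝ} (h : SolvesBVP M α x y) :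
    (∀ i, SobolevPath M.T (y i)) ∧ WeakEulerLagrange M α y := by
  have hu := uniqueDiffOn_Icc M.T_pos
  refine weakEulerLagrange_of_classical (v := fun i => derivWithin (y i) (Icc 0 M.T))
    (w := fun i => iteratedDerivWithin 2 (y i) (Icc 0 M.T)) (fun i t ht => ?_) (fun i t ht => ?_)
    h.2
  · exact (((h.1 i).1.differentiableOn (by norm_num)) t ht).hasDerivWithinAt
  · have h1 : DifferentiableOn ℝ (derivWithin (y i) (Icc 0 M.T)) (Icc 0 M.T) :=
      ((h.1 i).1.derivWithin hu (m := 1) (by norm_num)).differentiableOn (by norm_num)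
    have h2 := (h1 t ht).hasDerivWithinAt
    rw [iteratedDerivWithin_succ]
    convert! h2 using 1
    exact derivWithin_congr (fun s hs => by rw [iteratedDerivWithin_one])
      (by rw [iteratedDerivWithin_one])

lemma solvesBVP_of_hasDerivAt {x : Fin n → ℝ} (hy : ∀ i t, HasDerivAt (y i) (v i t) t)
    (hv : ∀ i t, HasDerivAt (v i) (w i t) t) (hw : ∀ i, Continuous (w i))
    (h0 : ∀ i, y i 0 = x i) (h1 : ∀ i, y i M.T = 0)
    (h : ∀ i, ∀ t ∈ Icc 0 M.T, α i * M.σ ^ 2 * y i t - 2 * M.lam * w i t =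
      M.b t + M.γ * ∑ j ∈ Finset.univ.erase i, v j t
        + M.lam * ∑ j ∈ Finset.univ.erase i, w j t) : SolvesBVP M α x y := by
  have hu := uniqueDiffOn_Icc M.T_pos
  have e1 : ∀ i, ∀ t ∈ Icc 0 M.T, derivWithin (y i) (Icc 0 M.T) t = v i t := fun i t ht =>
    (hy i t).hasDerivWithinAt.derivWithin (hu t ht)
  have e2 : ∀ i, ∀ t ∈ Icc 0 M.T, iteratedDerivWithin 2 (y i) (Icc 0 M.T) t = w i t := by
    intro i t ht
    rw [iteratedDerivWithin_succ, ← (hv i t).hasDerivWithinAt.derivWithin (hu t ht)]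
    exact derivWithin_congr (fun s hs => by rw [iteratedDerivWithin_one, e1 i s hs])
      (by rw [iteratedDerivWithin_one, e1 i t ht])
  refine ⟨fun i => ⟨ContDiff.contDiffOn ?_, h0 i, h1 i⟩, fun i t ht => ?_⟩
  · have d1 : deriv (y i) = v i := funext fun t => (hy i t).deriv
    have d2 : deriv (v i) = w i := funext fun t => (hv i t).deriv
    have hv1 : ContDiff ℝ 1 (v i) := by
      rw [contDiff_one_iff_deriv, d2]
      exact ⟨fun t => (hv i t).differentiableAt, hw i⟩
    rw [show (2 : WithTop ℕ∞) = 1 + 1 by norm_num, contDiff_succ_iff_deriv, d1]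
    exact ⟨fun t => (hy i t).differentiableAt, by simp, hv1⟩
  · rw [e2 i t ht, Finset.sum_congr rfl fun j _ => e1 j t ht,
      Finset.sum_congr rfl fun j _ => e2 j t ht]
    exact h i t ht

end Classical

/-! ### Existence by shooting. -/

/-- Variation of constants for a linear system with continuous inhomogeneity. -/
lemma exists_solution_linear_ode {E : Type*} [NormedAddCommGroup E] [NormedSpace ℝ E]
    [CompleteSpace E] (A : E →L[ℝ] E) {f : ℝ → E} (hf : Continuous f) :
    ∃ (Φ : ℝ → E →L[ℝ] E) (g : ℝ → E), Φ 0 = 1 ∧ g 0 = 0 ∧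
      ∀ z t, HasDerivAt (fun t => Φ t z + g t) (A (Φ t z + g t) + f t) t := by
  set Φ : ℝ → E →L[ℝ] E := fun t => NormedSpace.exp (t • A) with hΦ
  have hd : ∀ t, HasDerivAt Φ (A * Φ t) t := fun t => hasDerivAt_exp_smul_const' A t
  have hΦc : Continuous Φ := continuous_iff_continuousAt.2 fun t => (hd t).continuousAt
  have hinv : ∀ t, Φ t * Φ (-t) = 1 := fun t => by
    have hc : Commute (t • A) (-t • A) :=
      ((Commute.refl A).smul_left t).smul_right (-t)
    rw [hΦ]
    simp only
    let _ : NormedAlgebra ℚ (E →L[ℝ] E) := NormedAlgebra.restrictScalars ℚ ℝ _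
    rw [← NormedSpace.exp_add_of_commute hc, ← add_smul]
    simp
  set k : ℝ → E := fun s => Φ (-s) (f s) with hk
  have hkc : Continuous k := (hΦc.comp continuous_neg).clm_apply hf
  refine ⟨Φ, fun t => Φ t (∫ s in (0 : ℝ)..t, k s), by simp [hΦ], by simp, fun z t => ?_⟩
  have h1 : HasDerivAt (fun t => z + ∫ s in (0 : ℝ)..t, k s) (k t) t :=
    (hkc.integral_hasStrictDerivAt 0 t).hasDerivAt.const_add z
  have h2 := (hd t).clm_apply h1
  have h3 : Φ t (k t) = f t := by
    have := congrArg (fun B : E →L[ℝ] E => B (f t)) (hinv t)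
    simpa [hk] using this
  rw [h3] at h2
  simpa [map_add] using h2

section Existence

variable {n : ℕ}

/-- Second derivatives of the strategies, as a linear function of positions and rates. -/
noncomputable def accelMap (M : Market) (α : Fin n → ℝ) :
    (Fin n → ℝ) × (Fin n → ℝ) →ₗ[ℝ] (Fin n → ℝ) :=
  let r : (Fin n → ℝ) × (Fin n → ℝ) →ₗ[ℝ] (Fin n → ℝ) :=
    LinearMap.pi fun i => (α i * M.σ ^ 2) • (LinearMap.proj i ∘ₗ LinearMap.fst ℝ _ _)
      - M.γ • ∑ j ∈ Finset.univ.erase i, LinearMap.proj j ∘ₗ LinearMap.snd ℝ _ _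
  LinearMap.pi fun i => M.lam⁻¹ • (LinearMap.proj i ∘ₗ r
    - ((n : ℝ) + 1)⁻¹ • ∑ j, LinearMap.proj j ∘ₗ r)

/-- The system reads λ(wᵢ + Σⱼ wⱼ) = rᵢ - β. Summing over i gives λ(n + 1) Σⱼ wⱼ = Σⱼ rⱼ - nβ, and
substituting back isolates wᵢ. -/
lemma accelMap_spec (M : Market) (α : Fin n → ℝ) (z : (Fin n → ℝ) × (Fin n → ℝ)) (β : ℝ)
    {w : Fin n → ℝ} (hw : ∀ i, w i = accelMap M α z i - β / (M.lam * (n + 1))) (i : Fin n) :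
    α i * M.σ ^ 2 * z.1 i - 2 * M.lam * w i =
      β + M.γ * ∑ j ∈ Finset.univ.erase i, z.2 j + M.lam * ∑ j ∈ Finset.univ.erase i, w j := by
  have hlam := M.lam_pos.ne'
  have hn : (n : ℝ) + 1 ≠ 0 := by positivity
  set r : Fin n → ℝ := fun i => α i * M.σ ^ 2 * z.1 i - M.γ * ∑ j ∈ Finset.univ.erase i, z.2 j
    with hr
  have hacc : ∀ i, accelMap M α z i = M.lam⁻¹ * (r i - ((n : ℝ) + 1)⁻¹ * ∑ j, r j) := fun i => by
    simp [accelMap, hr, LinearMap.sum_apply]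
  have hsum : ∑ j, w j = M.lam⁻¹ * ((n : ℝ) + 1)⁻¹ * (∑ j, r j) - n * (β / (M.lam * (n + 1))) := by
    simp_rw [hw, hacc]
    rw [Finset.sum_sub_distrib, ← Finset.mul_sum, Finset.sum_sub_distrib]
    simp only [Finset.sum_const, Finset.card_univ, Fintype.card_fin, nsmul_eq_mul]
    field_simp
    ring
  have hsplit := Finset.add_sum_erase _ w (Finset.mem_univ i)
  have hri : α i * M.σ ^ 2 * z.1 i = r i + M.γ * ∑ j ∈ Finset.univ.erase i, z.2 j := by
    simp [hr]
  rw [hri, show ∑ j ∈ Finset.univ.erase i, w j = ∑ j, w j - w i by linarith, hsum, hw i, hacc i]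
  field_simp
  ring

/-- The terminal position is affine in the initial rates. Its linear part `S` is injective by
uniqueness of weak solutions, so any terminal position can be hit. -/
lemma exists_solvesBVP (M : Market) (α x : Fin n → ℝ) (hα : ∀ i, 0 ≤ α i) :
    ∃ X : Fin n → ℝ → ℝ, SolvesBVP M α x X := by
  set A : (Fin n → ℝ) × (Fin n → ℝ) →L[ℝ] (Fin n → ℝ) × (Fin n → ℝ) :=
    LinearMap.toContinuousLinearMap ((LinearMap.snd ℝ _ _).prod (accelMap M α)) with hA
  have hf : Continuous (fun t => ((0, fun _ => -(M.drift t / (M.lam * (n + 1)))) :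
      (Fin n → ℝ) × (Fin n → ℝ))) :=
    continuous_const.prodMk (continuous_pi fun _ => (M.continuous_drift.div_const _).neg)
  obtain ⟨Φ, g, hΦ0, hg0, hsol⟩ := exists_solution_linear_ode A hf
  set Y : (Fin n → ℝ) × (Fin n → ℝ) → Fin n → ℝ → ℝ := fun z i t => (Φ t z + g t).1 i with hY
  set V : (Fin n → ℝ) × (Fin n → ℝ) → Fin n → ℝ → ℝ := fun z i t => (Φ t z + g t).2 i with hV
  set K : (Fin n → ℝ) × (Fin n → ℝ) → Fin n → ℝ → ℝ := fun z i t =>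
    accelMap M α (Φ t z + g t) i - M.drift t / (M.lam * (n + 1)) with hK
  have hYd : ∀ z i t, HasDerivAt (Y z i) (V z i t) t := fun z i t => by
    have h1 := hasDerivAt_pi.1 ((hsol z t).fst) i
    rw [show V z i t = (A (Φ t z + g t) + (0, fun _ => -(M.drift t / (M.lam * (n + 1))))).1 i by
      simp [hA, hV]]
    exact h1
  have hVd : ∀ z i t, HasDerivAt (V z i) (K z i t) t := fun z i t => by
    have h1 := hasDerivAt_pi.1 ((hsol z t).snd) i
    rw [show K z i t = (A (Φ t z + g t) + (0, fun _ => -(M.drift t / (M.lam * (n + 1))))).2 i by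
      simp [hA, hK, sub_eq_add_neg]]
    exact h1
  have hKc : ∀ z i, Continuous (K z i) := fun z i => by
    have h1 : Continuous (fun t => Φ t z + g t) :=
      continuous_iff_continuousAt.2 fun t => (hsol z t).continuousAt
    have h2 : Continuous (accelMap M α) := LinearMap.continuous_of_finiteDimensional _
    exact (((continuous_apply i).comp h2).comp h1).sub (M.continuous_drift.div_const _)
  have heq : ∀ z i, ∀ t ∈ Icc 0 M.T, α i * M.σ ^ 2 * Y z i t - 2 * M.lam * K z i t =
      M.b t + M.γ * ∑ j ∈ Finset.univ.erase i, V z j t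
        + M.lam * ∑ j ∈ Finset.univ.erase i, K z j t := fun z i t ht => by
    rw [← M.drift_eq ht]
    exact accelMap_spec M α (Φ t z + g t) (M.drift t) (fun _ => rfl) i
  have hweak : ∀ z, (∀ i, SobolevPath M.T (Y z i)) ∧ WeakEulerLagrange M α (Y z) := fun z =>
    weakEulerLagrange_of_classical (fun i t _ => (hYd z i t).hasDerivWithinAt)
      (fun i t _ => (hVd z i t).hasDerivWithinAt) (heq z)
  have hY0 : ∀ z i, Y z i 0 = z.1 i := fun z i => by simp [hY, hΦ0, hg0]
  have hV0 : ∀ z i, V z i 0 = z.2 i := fun z i => by simp [hV, hΦ0, hg0]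
  set S : (Fin n → ℝ) →ₗ[ℝ] (Fin n → ℝ) :=
    LinearMap.fst ℝ _ _ ∘ₗ (Φ M.T).toLinearMap ∘ₗ LinearMap.inr ℝ _ _ with hS
  have hinj : Function.Injective S := by
    rw [injective_iff_map_eq_zero]
    intro u hu
    -- Both trajectories solve the same inhomogeneous system, so the drift need not be removed
    -- before applying uniqueness.
    have hends : ∀ i, Y (0, u) i M.T = Y 0 i M.T := fun i => by
      have : (Φ M.T (0, u)).1 i = 0 := congrFun hu i
      simp [hY, this]
    have hEq := fun i => (hweak (0, u)).2.eqOn hα (hweak (0, u)).1 (hweak 0).1 (hweak 0).2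
      (fun i => by simp [hY0]) hends i
    ext i
    have h0 : (0 : ℝ) ∈ Icc 0 M.T := ⟨le_rfl, M.T_pos.le⟩
    have d1 := (hYd (0, u) i 0).hasDerivWithinAt (s := Icc 0 M.T)
    have d2 := ((hYd 0 i 0).hasDerivWithinAt (s := Icc 0 M.T)).congr (hEq i) (hEq i h0)
    -- Coinciding paths have the same one-sided derivative at 0, and the initial rates are `u` and
    -- 0.
    have := (uniqueDiffOn_Icc M.T_pos 0 h0).eq_deriv _ d1 d2
    simpa [hV0] using this
  obtain ⟨u, hu⟩ := LinearMap.injective_iff_surjective.1 hinj (-(Φ M.T (x, 0) + g M.T).1)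
  refine ⟨Y (x, u), solvesBVP_of_hasDerivAt (hYd _) (hVd _) (hKc _) (fun i => hY0 _ i)
    (fun i => ?_) (heq _)⟩
  have hxu : ((x, u) : (Fin n → ℝ) × (Fin n → ℝ)) = (0, u) + (x, 0) := by simp
  have hui : (Φ M.T (0, u)).1 i = -(Φ M.T (x, 0) + g M.T).1 i := congrFun hu i
  simp only [hY]
  rw [hxu, map_add, Prod.fst_add, Pi.add_apply, Prod.fst_add, Pi.add_apply, hui]
  simp

end Existence

/-! ### Limit theorems and Riemann–Stieltjes sums. -/

section Limits

open Filter Topology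

/-- Convergence of expectations for nonnegative variables bounded in `L²`. -/
lemma integral_eq_one_of_tendsto_ae {Ω : Type*} [MeasurableSpace Ω] {P : Measure Ω}
    [IsProbabilityMeasure P] {f : ℕ → Ω → ℝ} {g : Ω → ℝ} {C : ℝ} (hpos : ∀ n ω, 0 ≤ f n ω)
    (hf : ∀ n, Integrable (f n) P) (hf1 : ∀ n, ∫ ω, f n ω ∂P = 1)
    (hf2 : ∀ n, Integrable (fun ω => f n ω ^ 2) P) (hfC : ∀ n, ∫ ω, f n ω ^ 2 ∂P ≤ C)
    (hlim : ∀ᵐ ω ∂P, Tendsto (fun n => f n ω) atTop (𝓝 (g ω))) :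
    Integrable g P ∧ ∫ ω, g ω ∂P = 1 := by
  have hgm : AEStronglyMeasurable g P :=
    aestronglyMeasurable_of_tendsto_ae atTop (fun n => (hf n).1) hlim
  have hg0 : 0 ≤ᵐ[P] g := by
    filter_upwards [hlim] with ω hω
    exact ge_of_tendsto' hω fun n => hpos n ω
  have hfatou : ∫⁻ ω, ENNReal.ofReal (g ω) ∂P ≤ 1 := by
    calc ∫⁻ ω, ENNReal.ofReal (g ω) ∂P
        = ∫⁻ ω, liminf (fun n => ENNReal.ofReal (f n ω)) atTop ∂P := by
          refine lintegral_congr_ae ?_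
          filter_upwards [hlim] with ω hω
          exact ((ENNReal.tendsto_ofReal hω).liminf_eq).symm
      _ ≤ liminf (fun n => ∫⁻ ω, ENNReal.ofReal (f n ω) ∂P) atTop :=
          lintegral_liminf_le' fun n => (hf n).1.aemeasurable.ennreal_ofReal
      _ = 1 := by
          have : ∀ n, ∫⁻ ω, ENNReal.ofReal (f n ω) ∂P = 1 := fun n => by
            rw [← ofReal_integral_eq_lintegral_ofReal (hf n) (ae_of_all _ (hpos n)), hf1]
            simp
          simp [this]
  have hgi : Integrable g P := by
    refine ⟨hgm, ?_⟩
    rw [hasFiniteIntegral_iff_ofReal hg0]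
    exact hfatou.trans_lt ENNReal.one_lt_top
  refine ⟨hgi, le_antisymm ?_ ?_⟩
  · rw [← ofReal_integral_eq_lintegral_ofReal hgi hg0] at hfatou
    simpa using hfatou
  -- No mass escapes: by `min f K ≥ f - f² / K`, truncation at `K` costs at most `C / K` uniformly
  -- in `n`, and truncated functions converge by domination.
  · have key : ∀ K : ℝ, 0 < K → 1 - C / K ≤ ∫ ω, g ω ∂P := by
      intro K hK
      have hmin : Tendsto (fun n => ∫ ω, min (f n ω) K ∂P) atTop (𝓝 (∫ ω, min (g ω) K ∂P)) := by
        refine tendsto_integral_of_dominated_convergence (fun _ => K)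
          (fun n => ((hf n).1.inf aestronglyMeasurable_const)) (integrable_const K)
          (fun n => ae_of_all _ fun ω => ?_) ?_
        · rw [Real.norm_of_nonneg (le_min (hpos n ω) hK.le)]
          exact min_le_right _ _
        · filter_upwards [hlim] with ω hω
          exact hω.min tendsto_const_nhds
      have h1 : 1 - C / K ≤ ∫ ω, min (g ω) K ∂P := by
        refine ge_of_tendsto' hmin fun n => ?_
        have h2 : ∫ ω, (f n ω - f n ω ^ 2 / K) ∂P ≤ ∫ ω, min (f n ω) K ∂P := by
          refine integral_mono ((hf n).sub ((hf2 n).div_const K))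
            ((hf n).inf (integrable_const K)) fun ω => le_min ?_ ?_
          · have : 0 ≤ f n ω ^ 2 / K := by positivity
            linarith
          · rw [sub_le_iff_le_add, ← sub_le_iff_le_add', le_div_iff₀ hK]
            nlinarith [sq_nonneg (f n ω - K), sq_nonneg (f n ω), sq_nonneg K]
        rw [integral_sub (hf n) ((hf2 n).div_const K), hf1, integral_div] at h2
        have h3 : (∫ ω, f n ω ^ 2 ∂P) / K ≤ C / K := div_le_div_of_nonneg_right (hfC n) hK.le
        linarith
      refine h1.trans (integral_mono (hgi.inf (integrable_const K)) hgi fun ω => min_le_left _ _)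
    have hl : Tendsto (fun K : ℝ => 1 - C / K) atTop (𝓝 (1 - 0)) :=
      tendsto_const_nhds.sub (tendsto_const_nhds.div_atTop tendsto_id)
    rw [sub_zero] at hl
    exact le_of_tendsto hl ((eventually_gt_atTop 0).mono key)

/-- Equidistant grid on `[0, T]` with `N + 1` steps. -/
noncomputable def grid (T : ℝ) (N k : ℕ) : ℝ := k * (T / (N + 1))

variable {T : ℝ}

lemma grid_zero (T : ℝ) (N : ℕ) : grid T N 0 = 0 := by simp [grid]

lemma grid_last (T : ℝ) (N : ℕ) : grid T N (N + 1) = T := by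
  unfold grid
  push_cast
  field_simp

lemma grid_succ_sub (T : ℝ) (N k : ℕ) : grid T N (k + 1) - grid T N k = T / (N + 1) := by
  unfold grid
  push_cast
  ring

lemma grid_mono (hT : 0 < T) (N : ℕ) : Monotone (grid T N) := by
  intro a b h
  unfold grid
  have : (a : ℝ) ≤ b := by exact_mod_cast h
  gcongr

lemma grid_nonneg (hT : 0 < T) (N k : ℕ) : 0 ≤ grid T N k := by
  unfold grid
  positivity

lemma grid_le (hT : 0 < T) {N k : ℕ} (hk : k ≤ N + 1) : grid T N k ≤ T :=
  (grid_mono hT N hk).trans_eq (grid_last T N)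

/-- Riemann--Stieltjes sums with respect to an absolutely continuous integrator. -/
lemma tendsto_sum_grid (hT : 0 < T) {w v : ℝ → ℝ} (hw : ContinuousOn w (Icc 0 T))
    (hv : IntervalIntegrable v volume 0 T) (s : ℕ → ℕ → ℝ)
    (hs : ∀ N k, s N k ∈ Icc (grid T N k) (grid T N (k + 1))) :
    Tendsto (fun N => ∑ k ∈ Finset.range (N + 1),
      w (s N k) * ∫ t in (grid T N k)..(grid T N (k + 1)), v t) atTop
      (𝓝 (∫ t in (0 : ℝ)..T, w t * v t)) := by
  have hwv : IntervalIntegrable (fun t => w t * v t) volume 0 T :=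
    hv.continuousOn_mul (by rwa [uIcc_of_le hT.le])
  have hA : 0 ≤ ∫ t in (0 : ℝ)..T, |v t| :=
    intervalIntegral.integral_nonneg hT.le fun _ _ => abs_nonneg _
  rw [Metric.tendsto_atTop]
  intro ε hε
  set A := ∫ t in (0 : ℝ)..T, |v t| with hAdef
  set e := ε / (A + 1) with he
  have he0 : 0 < e := by positivity
  obtain ⟨δ, hδ, H⟩ := Metric.uniformContinuousOn_iff.1
    (isCompact_Icc.uniformContinuousOn_of_continuous hw) e he0
  obtain ⟨N₀, hN₀⟩ := exists_nat_gt (T / δ)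
  refine ⟨N₀, fun N hN => ?_⟩
  have hmesh : T / (N + 1) < δ := by
    rw [div_lt_iff₀ (by positivity)]
    rw [div_lt_iff₀ hδ] at hN₀
    have : (N₀ : ℝ) ≤ N := by exact_mod_cast hN
    nlinarith
  have hsub : ∀ k < N + 1, Icc (grid T N k) (grid T N (k + 1)) ⊆ Icc 0 T := fun k hk =>
    Icc_subset_Icc (grid_nonneg hT N k) (grid_le hT hk)
  have hint : ∀ {f : ℝ → ℝ}, IntervalIntegrable f volume 0 T → ∀ k < N + 1,
      IntervalIntegrable f volume (grid T N k) (grid T N (k + 1)) := fun hf k hk => by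
    refine hf.mono_set ?_
    rw [uIcc_of_le (grid_mono hT N k.le_succ), uIcc_of_le hT.le]
    exact hsub k hk
  have e1 : ∫ t in (0 : ℝ)..T, w t * v t = ∑ k ∈ Finset.range (N + 1),
      ∫ t in (grid T N k)..(grid T N (k + 1)), w t * v t := by
    rw [intervalIntegral.sum_integral_adjacent_intervals fun k hk => hint hwv k hk, grid_zero,
      grid_last]
  have e2 : A = ∑ k ∈ Finset.range (N + 1),
      ∫ t in (grid T N k)..(grid T N (k + 1)), |v t| := by
    rw [intervalIntegral.sum_integral_adjacent_intervals fun k hk => hint hv.abs k hk, grid_zero,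
      grid_last]
  rw [Real.dist_eq, e1, ← Finset.sum_sub_distrib]
  calc |∑ k ∈ Finset.range (N + 1), (w (s N k) * (∫ t in (grid T N k)..(grid T N (k + 1)), v t)
        - ∫ t in (grid T N k)..(grid T N (k + 1)), w t * v t)|
      ≤ ∑ k ∈ Finset.range (N + 1), |w (s N k) * (∫ t in (grid T N k)..(grid T N (k + 1)), v t)
        - ∫ t in (grid T N k)..(grid T N (k + 1)), w t * v t| := Finset.abs_sum_le_sum_abs _ _
    _ ≤ ∑ k ∈ Finset.range (N + 1), e * ∫ t in (grid T N k)..(grid T N (k + 1)), |v t| := by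
        refine Finset.sum_le_sum fun k hk => ?_
        have hk' := Finset.mem_range.1 hk
        rw [← intervalIntegral.integral_const_mul, ← intervalIntegral.integral_const_mul,
          ← intervalIntegral.integral_sub ((hint hv k hk').const_mul _) (hint hwv k hk')]
        rw [← Real.norm_eq_abs]
        refine intervalIntegral.norm_integral_le_of_norm_le (grid_mono hT N k.le_succ)
          (ae_of_all _ fun t ht => ?_) ((hint hv.abs k hk').const_mul e)
        rw [← sub_mul, norm_mul, Real.norm_eq_abs (v t)]
        refine mul_le_mul_of_nonneg_right ?_ (abs_nonneg _)
        have ht' : t ∈ Icc (grid T N k) (grid T N (k + 1)) := Ioc_subset_Icc_self ht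
        refine (H _ (hsub k hk' (hs N k)) _ (hsub k hk' ht') ?_).le
        refine (Real.dist_le_of_mem_Icc (hs N k) ht').trans_lt ?_
        rwa [grid_succ_sub]
    _ = e * A := by rw [← Finset.mul_sum, ← e2]
    _ < ε := by
        rw [he, div_mul_eq_mul_div, div_lt_iff₀ (by positivity)]
        nlinarith

/-- Left-point sums of `y` against `w` converge to minus the integral of `w` against `y'`. -/
lemma tendsto_sum_left_point (hT : 0 < T) {w y : ℝ → ℝ} (hw : ContinuousOn w (Icc 0 T))
    (hw0 : w 0 = 0) (hy : SobolevPath T y) (hyT : y T = 0) :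
    Tendsto (fun N => ∑ k ∈ Finset.range (N + 1),
      y (grid T N k) * (w (grid T N (k + 1)) - w (grid T N k))) atTop
      (𝓝 (-∫ t in (0 : ℝ)..T, deriv y t * w t)) := by
  have hv := hy.ac.intervalIntegrable_deriv
  -- Sampling at right end points, because summation by parts pairs left values of `y` with right
  -- values of `w`; the boundary terms vanish by `hw0` and `hyT`.
  have h := (tendsto_sum_grid hT hw hv (fun N k => grid T N (k + 1))
    fun N k => ⟨grid_mono hT N k.le_succ, le_rfl⟩).neg
  simp_rw [mul_comm (w _) (deriv y _)] at h
  refine h.congr fun N => ?_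
  have e : ∀ k ∈ Finset.range (N + 1), w (grid T N (k + 1)) *
      ∫ t in (grid T N k)..(grid T N (k + 1)), deriv y t =
      (y (grid T N (k + 1)) * w (grid T N (k + 1)) - y (grid T N k) * w (grid T N k))
        - y (grid T N k) * (w (grid T N (k + 1)) - w (grid T N k)) := by
    intro k hk
    have hk' := Finset.mem_range.1 hk
    rw [(hy.ac.mono ?_).integral_deriv_eq_sub]
    · ring
    · rw [uIcc_of_le (grid_mono hT N k.le_succ), uIcc_of_le hT.le]
      exact Icc_subset_Icc (grid_nonneg hT N k) (grid_le hT hk')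
  rw [Finset.sum_congr rfl e, Finset.sum_sub_distrib,
    Finset.sum_range_sub (fun k => y (grid T N k) * w (grid T N k)), grid_zero, grid_last, hw0, hyT]
  ring

lemma tendsto_sum_sq (hT : 0 < T) {y : ℝ → ℝ} (hy : ContinuousOn y (Icc 0 T)) :
    Tendsto (fun N : ℕ => ∑ k ∈ Finset.range (N + 1), y (grid T N k) ^ 2 * (T / (N + 1))) atTop
      (𝓝 (∫ t in (0 : ℝ)..T, y t ^ 2)) := by
  have h := tendsto_sum_grid hT (hy.pow 2) (v := fun _ => 1) (by simp) (fun N k => grid T N k)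
    fun N k => ⟨le_rfl, grid_mono hT N k.le_succ⟩
  simpa [grid_succ_sub] using h

end Limits

/-! ### One Gaussian step of the exponential martingale. -/

lemma lintegral_exp_gaussianReal (δ : ℝ≥0) (r : ℝ) :
    ∫⁻ u, ENNReal.ofReal (Real.exp (-(r * u) - r ^ 2 / 2 * δ)) ∂(gaussianReal 0 δ) = 1 := by
  have h1 : ∀ u : ℝ, Real.exp (-(r * u) - r ^ 2 / 2 * δ)
      = Real.exp (-r * u) * Real.exp (-(r ^ 2 / 2 * δ)) := fun u => by
    rw [← Real.exp_add]; ring_nf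
  simp_rw [h1]
  have hi : Integrable (fun u : ℝ => Real.exp (-r * u) * Real.exp (-(r ^ 2 / 2 * δ)))
      (gaussianReal 0 δ) := (integrable_exp_mul_gaussianReal (-r)).mul_const _
  rw [← ofReal_integral_eq_lintegral_ofReal hi (ae_of_all _ fun u => by positivity),
    integral_mul_const]
  have h2 : ∫ u, Real.exp (-r * u) ∂(gaussianReal 0 δ) = Real.exp (δ * r ^ 2 / 2) := by
    have := congrFun (mgf_id_gaussianReal (μ := 0) (v := δ)) (-r)
    simpa [mgf] using this
  rw [h2, ← Real.exp_add]
  ring_nf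
  simp

/-- One step of the exponential martingale. -/
lemma lintegral_mul_exp_of_indep {Ω : Type*} {m mΩ : MeasurableSpace Ω} {P : Measure Ω}
    [IsProbabilityMeasure P] (hm : m ≤ mΩ) {H : Ω → ℝ≥0∞} (hH : Measurable[m] H) {y D : Ω → ℝ} (hy : Measurable[m] y)
    (hD : Measurable D) (hind : Indep (MeasurableSpace.comap D inferInstance) m P) {δ : ℝ≥0}
    (hlaw : P.map D = gaussianReal 0 δ) :
    ∫⁻ ω, H ω * ENNReal.ofReal (Real.exp (-(y ω * D ω) - y ω ^ 2 / 2 * δ)) ∂P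
      = ∫⁻ ω, H ω ∂P := by
  have hHy : Measurable[m] (fun ω => (H ω, y ω)) := hH.prodMk hy
  have hHy' : Measurable (fun ω => (H ω, y ω)) := hHy.mono hm le_rfl
  -- The past weight and the integrand enter jointly, so the pair must be independent of the
  -- increment; Fubini then integrates the increment out first.
  have hI : IndepFun (fun ω => (H ω, y ω)) D P := by
    rw [IndepFun_iff_Indep]
    exact indep_of_indep_of_le_left hind.symm hHy.comap_le
  rw [indepFun_iff_map_prod_eq_prod_map_map hHy'.aemeasurable hD.aemeasurable, hlaw] at hI
  set φ : (ℝ≥0∞ × ℝ) × ℝ → ℝ≥0∞ := fun q =>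
    q.1.1 * ENNReal.ofReal (Real.exp (-(q.1.2 * q.2) - q.1.2 ^ 2 / 2 * δ)) with hφ
  have hφm : Measurable φ := by fun_prop
  calc ∫⁻ ω, H ω * ENNReal.ofReal (Real.exp (-(y ω * D ω) - y ω ^ 2 / 2 * δ)) ∂P
      = ∫⁻ q, φ q ∂(P.map fun ω => ((H ω, y ω), D ω)) :=
        (lintegral_map hφm (hHy'.prodMk hD)).symm
    _ = ∫⁻ q, ∫⁻ u, φ (q, u) ∂(gaussianReal 0 δ) ∂(P.map fun ω => (H ω, y ω)) := by
        rw [hI, lintegral_prod _ hφm.aemeasurable]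
    _ = ∫⁻ q, q.1 ∂(P.map fun ω => (H ω, y ω)) := by
        refine lintegral_congr fun q => ?_
        simp only [hφ]
        rw [lintegral_const_mul _ (by fun_prop), lintegral_exp_gaussianReal, mul_one]
    _ = ∫⁻ ω, H ω ∂P := lintegral_map measurable_fst hHy'

/-! ### Integrals of strategies against Brownian motion. -/

section Brownian

variable {Ω : Type*}

/-- The integral `∫ X dW` of a strategy with `X T = 0`, defined pathwise by parts. -/
noncomputable def pathIntegral (T : ℝ) (W : ℝ≥0 → Ω → ℝ) (X : ℝ → Ω → ℝ) (ω : Ω) : ℝ :=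
  -∫ t in (0 : ℝ)..T, rate X t ω * W t.toNNReal ω

/-- Left-point approximation of `∫ X dW`. -/
noncomputable def stepIntegral (T : ℝ) (W : ℝ≥0 → Ω → ℝ) (X : ℝ → Ω → ℝ) (N : ℕ) (ω : Ω) : ℝ :=
  ∑ k ∈ Finset.range (N + 1), X (grid T N k) ω *
    (W (grid T N (k + 1)).toNNReal ω - W (grid T N k).toNNReal ω)

/-- Left-point approximation of `∫ X² dt`. -/
noncomputable def stepSquare (T : ℝ) (X : ℝ → Ω → ℝ) (N : ℕ) (ω : Ω) : ℝ :=
  ∑ k ∈ Finset.range (N + 1), X (grid T N k) ω ^ 2 * (T / (N + 1))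

lemma stepSquare_le {T : ℝ} {X : ℝ → Ω → ℝ} (hT : 0 < T) {c : ℝ} (hc : ∀ t ∈ Icc 0 T, ∀ ω, |X t ω| ≤ c) (N : ℕ) (ω : Ω) :
    stepSquare T X N ω ≤ c ^ 2 * T := by
  calc stepSquare T X N ω ≤ ∑ k ∈ Finset.range (N + 1), c ^ 2 * (T / (N + 1)) := by
        refine Finset.sum_le_sum fun k hk => mul_le_mul_of_nonneg_right ?_ (by positivity)
        exact sq_le_sq.2 ((hc _ ⟨grid_nonneg hT N k,
          grid_le hT (Finset.mem_range.1 hk).le⟩ ω).trans (le_abs_self c))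
    _ = c ^ 2 * T := by
        rw [Finset.sum_const, Finset.card_range, nsmul_eq_mul]
        push_cast
        field_simp

variable [mΩ : MeasurableSpace Ω] {F : Filtration ℝ≥0 mΩ} {T x : ℝ} {X : ℝ → Ω → ℝ}

lemma Admissible.measurable_grid (hT : 0 < T) (hX : Admissible F T x X) {N k : ℕ}
    (hk : k < N + 1) : Measurable[F (grid T N k).toNNReal] (X (grid T N k)) := by
  have h := hX.adapted (grid T N k).toNNReal
    (by rw [Real.coe_toNNReal _ (grid_nonneg hT N k)]; exact grid_le hT hk.le)
  rwa [Real.coe_toNNReal _ (grid_nonneg hT N k)] at h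

lemma measurable_stepSquare (hT : 0 < T) (hX : Admissible F T x X) (N : ℕ) :
    Measurable (stepSquare T X N) :=
  Finset.measurable_sum _ fun _ hk =>
    (((hX.measurable_grid hT (Finset.mem_range.1 hk)).mono (F.le _) le_rfl).pow_const 2).mul_const _

lemma tendsto_stepSquare (hT : 0 < T) (hX : Admissible F T x X) (ω : Ω) :
    Filter.Tendsto (fun N => stepSquare T X N ω) Filter.atTop
      (nhds (∫ t in (0 : ℝ)..T, X t ω ^ 2)) :=
  tendsto_sum_sq (y := fun t => X t ω) hT ((hX.sobolevPath hT ω).continuousOn hT)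

lemma integral_sq_le (hT : 0 < T) (hX : Admissible F T x X) {c : ℝ}
    (hc : ∀ t ∈ Icc 0 T, ∀ ω, |X t ω| ≤ c) (ω : Ω) :
    ∫ t in (0 : ℝ)..T, X t ω ^ 2 ≤ c ^ 2 * T :=
  le_of_tendsto' (tendsto_stepSquare hT hX ω) fun N => stepSquare_le hT hc N ω

variable {P : Measure Ω} {W : ℝ≥0 → Ω → ℝ}

lemma IsFilteredBrownian.measurable (hW : IsFilteredBrownian F P W) (t : ℝ≥0) :
    Measurable (W t) :=
  (hW.adapted t).mono (F.le t) le_rfl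

lemma IsFilteredBrownian.ae_path (hW : IsFilteredBrownian F P W) :
    ∀ᵐ ω ∂P, Continuous (fun t : ℝ => W t.toNNReal ω) ∧ W 0 ω = 0 := by
  filter_upwards [hW.brownian.cont, hW.brownian.eval_zero_ae_eq_zero] with ω h1 h2
  exact ⟨h1.comp continuous_real_toNNReal, h2⟩

lemma measurable_stepIntegral (hT : 0 < T) (hW : IsFilteredBrownian F P W)
    (hX : Admissible F T x X) (N : ℕ) : Measurable (stepIntegral T W X N) :=
  Finset.measurable_sum _ fun _ hk =>
    ((hX.measurable_grid hT (Finset.mem_range.1 hk)).mono (F.le _) le_rfl).mul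
      ((hW.measurable _).sub (hW.measurable _))

lemma ae_tendsto_stepIntegral (hT : 0 < T) (hW : IsFilteredBrownian F P W)
    (hX : Admissible F T x X) : ∀ᵐ ω ∂P, Filter.Tendsto (fun N => stepIntegral T W X N ω)
      Filter.atTop (nhds (pathIntegral T W X ω)) := by
  filter_upwards [hW.ae_path] with ω hω
  exact tendsto_sum_left_point hT hω.1.continuousOn (by simpa using hω.2) (hX.sobolevPath hT ω)
    (hX.liquidation ω)

lemma aestronglyMeasurable_pathIntegral (hT : 0 < T) (hW : IsFilteredBrownian F P W)
    (hX : Admissible F T x X) : AEStronglyMeasurable (pathIntegral T W X) P :=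
  aestronglyMeasurable_of_tendsto_ae Filter.atTop
    (fun N => (measurable_stepIntegral hT hW hX N).aestronglyMeasurable)
    (ae_tendsto_stepIntegral hT hW hX)

lemma IsFilteredBrownian.map_sub (hW : IsFilteredBrownian F P W) {s t : ℝ≥0} (hst : s ≤ t) :
    P.map (fun ω => W t ω - W s ω) = gaussianReal 0 (t - s) := by
  have h := (hW.brownian.hasLaw_sub t s).map_eq
  rw [show (fun ω => W t ω - W s ω) = W t - W s from rfl, h]
  congr 1
  have h1 : (s : ℝ) ≤ t := by exact_mod_cast hst
  ext
  rw [coe_nndist, Real.dist_eq, NNReal.coe_sub hst]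
  exact abs_of_nonneg (sub_nonneg.2 h1)

variable [IsProbabilityMeasure P]

/-- The exponential martingale of a step integrand has expectation one. -/
lemma IsFilteredBrownian.lintegral_prod_exp (hW : IsFilteredBrownian F P W) {τ : ℕ → ℝ≥0}
    (hτ : Monotone τ) {y : ℕ → Ω → ℝ} (K : ℕ) (hy : ∀ k < K, Measurable[F (τ k)] (y k)) :
    ∫⁻ ω, ∏ k ∈ Finset.range K, ENNReal.ofReal (Real.exp
      (-(y k ω * (W (τ (k + 1)) ω - W (τ k) ω))
        - y k ω ^ 2 / 2 * ((τ (k + 1) - τ k : ℝ≥0) : ℝ))) ∂P = 1 := by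
  induction K with
  | zero => simp
  | succ K ih =>
    simp_rw [Finset.prod_range_succ]
    refine (lintegral_mul_exp_of_indep (F.le (τ K)) (D := fun ω => W (τ (K + 1)) ω - W (τ K) ω)
      ?_ (hy K K.lt_succ_self) ((hW.measurable _).sub (hW.measurable _))
      (hW.indep _ _ (hτ K.le_succ)) (hW.map_sub (hτ K.le_succ))).trans ?_
    rotate_left
    · exact ih fun k hk => hy k (hk.trans K.lt_succ_self)
    · refine Finset.measurable_prod _ fun k hk => ?_
      have hk' := Finset.mem_range.1 hk
      have m1 : Measurable[F (τ K)] (y k) :=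
        (hy k (hk'.trans K.lt_succ_self)).mono (F.mono (hτ hk'.le)) le_rfl
      have m2 : Measurable[F (τ K)] (W (τ (k + 1))) :=
        (hW.adapted _).mono (F.mono (hτ hk')) le_rfl
      have m3 : Measurable[F (τ K)] (W (τ k)) :=
        (hW.adapted _).mono (F.mono (hτ hk'.le)) le_rfl
      exact (Real.measurable_exp.comp (((m1.mul (m2.sub m3)).neg).sub
        (((m1.pow_const 2).div_const 2).mul_const _))).ennreal_ofReal

lemma integral_exp_step (hT : 0 < T) (hW : IsFilteredBrownian F P W) (hX : Admissible F T x X)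
    (θ : ℝ) (N : ℕ) :
    Integrable (fun ω => Real.exp (-(θ * stepIntegral T W X N ω)
        - θ ^ 2 / 2 * stepSquare T X N ω)) P ∧
      ∫ ω, Real.exp (-(θ * stepIntegral T W X N ω) - θ ^ 2 / 2 * stepSquare T X N ω) ∂P = 1 := by
  have hmono : Monotone fun k => (grid T N k).toNNReal := fun a b h =>
    Real.toNNReal_le_toNNReal (grid_mono hT N h)
  have h := hW.lintegral_prod_exp hmono (y := fun k ω => θ * X (grid T N k) ω) (N + 1)
    fun k hk => (hX.measurable_grid hT hk).const_mul θ
  have hstep : ∀ k, (((grid T N (k + 1)).toNNReal - (grid T N k).toNNReal : ℝ≥0) : ℝ)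
      = T / (N + 1) := fun k => by
    rw [NNReal.coe_sub (hmono k.le_succ), Real.coe_toNNReal _ (grid_nonneg hT N _),
      Real.coe_toNNReal _ (grid_nonneg hT N _), grid_succ_sub]
  have hl : ∫⁻ ω, ENNReal.ofReal (Real.exp (-(θ * stepIntegral T W X N ω)
      - θ ^ 2 / 2 * stepSquare T X N ω)) ∂P = 1 := by
    rw [← h]
    refine lintegral_congr fun ω => ?_
    rw [← ENNReal.ofReal_prod_of_nonneg fun _ _ => (Real.exp_pos _).le, ← Real.exp_sum]
    congr 2
    simp only [hstep]
    rw [Finset.sum_sub_distrib, Finset.sum_neg_distrib, stepIntegral, stepSquare, Finset.mul_sum,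
      Finset.mul_sum]
    congr 1
    · congr 1
      exact Finset.sum_congr rfl fun k _ => by ring
    · exact Finset.sum_congr rfl fun k _ => by ring
  have hm : Measurable (fun ω => Real.exp (-(θ * stepIntegral T W X N ω)
      - θ ^ 2 / 2 * stepSquare T X N ω)) :=
    Real.measurable_exp.comp (((measurable_stepIntegral hT hW hX N).const_mul θ).neg.sub
      ((measurable_stepSquare hT hX N).const_mul _))
  have hpos : 0 ≤ᵐ[P] fun ω => Real.exp (-(θ * stepIntegral T W X N ω)
      - θ ^ 2 / 2 * stepSquare T X N ω) := ae_of_all _ fun _ => (Real.exp_pos _).le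
  refine ⟨⟨hm.aestronglyMeasurable, ?_⟩, ?_⟩
  · rw [hasFiniteIntegral_iff_ofReal hpos, hl]
    exact ENNReal.one_lt_top
  · rw [integral_eq_lintegral_of_nonneg_ae hpos hm.aestronglyMeasurable, hl]
    simp

/-- The stochastic exponential of a bounded strategy has expectation one. -/
lemma integral_exp_pathIntegral (hT : 0 < T) (hW : IsFilteredBrownian F P W)
    (hX : Admissible F T x X) (θ : ℝ) :
    Integrable (fun ω => Real.exp (-(θ * pathIntegral T W X ω)
        - θ ^ 2 / 2 * ∫ t in (0 : ℝ)..T, X t ω ^ 2)) P ∧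
      ∫ ω, Real.exp (-(θ * pathIntegral T W X ω)
        - θ ^ 2 / 2 * ∫ t in (0 : ℝ)..T, X t ω ^ 2) ∂P = 1 := by
  obtain ⟨c, -, hc⟩ := hX.bounded
  have h1 := integral_exp_step hT hW hX θ
  have h2 := integral_exp_step hT hW hX (2 * θ)
  -- The square of the exponential at θ is the one at 2θ times exp(θ² `stepSquare`). Boundedness of
  -- the strategy thus gives the L² bound needed to pass to the limit.
  have hle : ∀ N ω, Real.exp (-(θ * stepIntegral T W X N ω)
      - θ ^ 2 / 2 * stepSquare T X N ω) ^ 2 ≤ Real.exp (θ ^ 2 * (c ^ 2 * T)) *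
      Real.exp (-(2 * θ * stepIntegral T W X N ω)
        - (2 * θ) ^ 2 / 2 * stepSquare T X N ω) := by
    intro N ω
    rw [← Real.exp_nat_mul, ← Real.exp_add]
    refine Real.exp_le_exp.2 ?_
    push_cast
    nlinarith [mul_le_mul_of_nonneg_left (stepSquare_le hT hc N ω) (sq_nonneg θ)]
  have hsq : ∀ N, Integrable (fun ω => Real.exp (-(θ * stepIntegral T W X N ω)
      - θ ^ 2 / 2 * stepSquare T X N ω) ^ 2) P := fun N => by
    refine ((h2 N).1.const_mul (Real.exp (θ ^ 2 * (c ^ 2 * T)))).mono' ((h1 N).1.1.pow 2)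
      (ae_of_all _ fun ω => ?_)
    rw [Real.norm_of_nonneg (by positivity)]
    exact hle N ω
  refine integral_eq_one_of_tendsto_ae (C := Real.exp (θ ^ 2 * (c ^ 2 * T)))
    (fun N ω => (Real.exp_pos _).le) (fun N => (h1 N).1) (fun N => (h1 N).2) hsq (fun N => ?_) ?_
  · refine (integral_mono (hsq N) ((h2 N).1.const_mul _) (hle N)).trans_eq ?_
    rw [integral_const_mul, (h2 N).2, mul_one]
  · filter_upwards [ae_tendsto_stepIntegral hT hW hX] with ω hω
    exact (Real.continuous_exp.tendsto _).comp (((hω.const_mul θ).neg).sub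
      ((tendsto_stepSquare hT hX ω).const_mul (θ ^ 2 / 2)))

/-- The compensator ∫X² dt is at most c²T, so it can be taken out of the stochastic exponential at
-θ. -/
lemma integrable_exp_mul_pathIntegral (hT : 0 < T) (hW : IsFilteredBrownian F P W)
    (hX : Admissible F T x X) {c : ℝ} (hc : ∀ t ∈ Icc 0 T, ∀ ω, |X t ω| ≤ c) (θ : ℝ) :
    Integrable (fun ω => Real.exp (θ * pathIntegral T W X ω)) P ∧
      ∫ ω, Real.exp (θ * pathIntegral T W X ω) ∂P ≤ Real.exp (θ ^ 2 / 2 * (c ^ 2 * T)) := by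
  obtain ⟨h1, h2⟩ := integral_exp_pathIntegral hT hW hX (-θ)
  have hle : ∀ ω, Real.exp (θ * pathIntegral T W X ω) ≤ Real.exp (θ ^ 2 / 2 * (c ^ 2 * T)) *
      Real.exp (-(-θ * pathIntegral T W X ω)
        - (-θ) ^ 2 / 2 * ∫ t in (0 : ℝ)..T, X t ω ^ 2) := fun ω => by
    rw [← Real.exp_add]
    refine Real.exp_le_exp.2 ?_
    nlinarith [mul_le_mul_of_nonneg_left (integral_sq_le hT hX hc ω) (sq_nonneg θ)]
  have hi : Integrable (fun ω => Real.exp (θ * pathIntegral T W X ω)) P := by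
    refine (h1.const_mul (Real.exp (θ ^ 2 / 2 * (c ^ 2 * T)))).mono'
      (Real.continuous_exp.comp_aestronglyMeasurable
        ((aestronglyMeasurable_pathIntegral hT hW hX).const_mul θ)) (ae_of_all _ fun ω => ?_)
    rw [Real.norm_of_nonneg (Real.exp_pos _).le]
    exact hle ω
  refine ⟨hi, (integral_mono hi (h1.const_mul _) hle).trans_eq ?_⟩
  rw [integral_const_mul, h2, mul_one]

/-- By eˣ ≥ 1 + x, the function exp(θ²c²T/2) - θm of θ, with m the mean, is at least 1, its value at
θ = 0. Its derivative -m there must vanish. -/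
lemma integral_pathIntegral (hT : 0 < T) (hW : IsFilteredBrownian F P W)
    (hX : Admissible F T x X) :
    Integrable (pathIntegral T W X) P ∧ ∫ ω, pathIntegral T W X ω ∂P = 0 := by
  obtain ⟨c, -, hc⟩ := hX.bounded
  have hexp := integrable_exp_mul_pathIntegral hT hW hX hc
  have hi : Integrable (pathIntegral T W X) P := by
    refine ((hexp 1).1.add (hexp (-1)).1).mono' (aestronglyMeasurable_pathIntegral hT hW hX)
      (ae_of_all _ fun ω => ?_)
    have e1 := Real.add_one_le_exp (1 * pathIntegral T W X ω)
    have e2 := Real.add_one_le_exp (-1 * pathIntegral T W X ω)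
    have e3 := Real.exp_pos (1 * pathIntegral T W X ω)
    have e4 := Real.exp_pos (-1 * pathIntegral T W X ω)
    rw [Real.norm_eq_abs, Pi.add_apply, abs_le]
    constructor <;> linarith
  refine ⟨hi, ?_⟩
  set m := ∫ ω, pathIntegral T W X ω ∂P with hm
  have key : ∀ θ : ℝ, 1 ≤ Real.exp (θ ^ 2 / 2 * (c ^ 2 * T)) - θ * m := by
    intro θ
    have h : ∫ ω, (θ * pathIntegral T W X ω + 1) ∂P
        ≤ ∫ ω, Real.exp (θ * pathIntegral T W X ω) ∂P :=
      integral_mono ((hi.const_mul θ).add (integrable_const 1)) (hexp θ).1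
        fun ω => Real.add_one_le_exp _
    rw [integral_add (hi.const_mul θ) (integrable_const 1), integral_const_mul] at h
    have h' := h.trans (hexp θ).2
    simp at h'
    linarith
  have hder : HasDerivAt (fun θ : ℝ => Real.exp (θ ^ 2 / 2 * (c ^ 2 * T)) - θ * m)
      (Real.exp ((0 : ℝ) ^ 2 / 2 * (c ^ 2 * T)) * (((2 : ℕ) * (0 : ℝ) ^ (2 - 1)) / 2 * (c ^ 2 * T))
        - 1 * m) 0 :=
    ((((hasDerivAt_pow 2 (0 : ℝ)).div_const 2).mul_const _).exp).sub
      ((hasDerivAt_id (0 : ℝ)).mul_const m)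
  have hmin : IsLocalMin (fun θ : ℝ => Real.exp (θ ^ 2 / 2 * (c ^ 2 * T)) - θ * m) 0 :=
    Filter.Eventually.of_forall fun θ => by simpa using key θ
  have := hmin.hasDerivAt_eq_zero hder
  simpa using this

/-- The variance of the pathwise integral of a deterministic strategy. -/
lemma variance_pathIntegral (hT : 0 < T) (hW : IsFilteredBrownian F P W)
    (hX : Admissible F T x X) {q : ℝ} (hq : ∀ ω, ∫ t in (0 : ℝ)..T, X t ω ^ 2 = q) :
    variance (pathIntegral T W X) P = q := by
  obtain ⟨c, -, hc⟩ := hX.bounded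
  have hq0 : 0 ≤ q := by
    obtain ⟨ω⟩ : Nonempty Ω := P.nonempty_of_neZero
    rw [← hq ω]
    exact intervalIntegral.integral_nonneg hT.le fun _ _ => sq_nonneg _
  have hexp := integrable_exp_mul_pathIntegral hT hW hX hc
  -- With ∫X² dt equal to the constant `q`, expectation one of the stochastic exponential is the
  -- Gaussian moment generating function. Being finite everywhere, it determines the law.
  have hmgf : mgf (pathIntegral T W X) P = mgf id (gaussianReal 0 q.toNNReal) := by
    rw [mgf_id_gaussianReal]
    ext θ
    have h := (integral_exp_pathIntegral hT hW hX (-θ)).2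
    simp_rw [hq, sub_eq_add_neg, Real.exp_add] at h
    rw [integral_mul_const] at h
    simp only [neg_mul, neg_neg, even_two, Even.neg_pow] at h
    rw [mgf, eq_div_of_mul_eq (Real.exp_pos _).ne' h, Real.exp_neg, one_div, inv_inv,
      Real.coe_toNNReal _ hq0]
    congr 1
    ring
  have huniv : integrableExpSet (pathIntegral T W X) P = univ :=
    eq_univ_of_forall fun θ => (hexp θ).1
  have hmeas := (aestronglyMeasurable_pathIntegral hT hW hX).aemeasurable
  have hmap := Measure.ext_of_complexMGF_eq hmeas aemeasurable_id (funext fun z =>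
    eqOn_complexMGF_of_mgf hmgf (by simp [huniv]))
  rw [Measure.map_id] at hmap
  rw [HasLaw.variance_eq ⟨hmeas, hmap⟩, variance_id_gaussianReal, Real.coe_toNNReal _ hq0]

end Brownian

/-! ### Decomposition of the revenues. -/

section Revenues

lemma deriv_eq_of_eqOn_Icc {T : ℝ} {f g : ℝ → ℝ} (h : EqOn f g (Icc 0 T)) {t : ℝ}
    (ht : t ∈ Ioo 0 T) : deriv f t = deriv g t := by
  refine Filter.EventuallyEq.deriv_eq ?_
  filter_upwards [Ioo_mem_nhds ht.1 ht.2] with s hs using h ⟨hs.1.le, hs.2.le⟩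

lemma pathObjective_congr {T lam a : ℝ} {p y z : ℝ → ℝ} (h : EqOn y z (Icc 0 T)) :
    pathObjective T lam a p y = pathObjective T lam a p z := by
  unfold pathObjective
  congr 1
  refine integral_congr_ae ?_
  filter_upwards [ae_timeMeasure_mem_Ioo T] with t ht
  rw [deriv_eq_of_eqOn_Icc h ht, h ⟨ht.1.le, ht.2.le⟩]

variable {Ω : Type*} [mΩ : MeasurableSpace Ω] {F : Filtration ℝ≥0 mΩ} {W : ℝ≥0 → Ω → ℝ}
  {M : Market} {n : ℕ} {X : Fin n → ℝ → Ω → ℝ} {y : Fin n → ℝ → ℝ} {i : Fin n} {x : ℝ}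

/-- Decomposition of the revenues into a stochastic integral and a functional of the path. -/
lemma revenues_eq (hy : ∀ j, SobolevPath M.T (y j))
    (hX : ∀ j, ∀ t ∈ Icc 0 M.T, ∀ ω, X j t ω = y j t) {Z : ℝ → Ω → ℝ}
    (hZ : Admissible F M.T x Z) {ω : Ω} (hω : Continuous (fun t : ℝ => W t.toNNReal ω)) (a : ℝ) :
    revenues M W X i Z ω = M.σ * pathIntegral M.T W Z ω
      + (pathObjective M.T M.lam a (exogenousPrice M y i) (fun t => Z t ω) - M.γ * x ^ 2 / 2)
      + a / 2 * ∫ t in (0 : ℝ)..M.T, Z t ω ^ 2 := by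
  have hT := M.T_pos
  set z : ℝ → ℝ := fun t => Z t ω with hz
  have hzS : SobolevPath M.T z := hZ.sobolevPath hT ω
  have hz0 : z 0 = x := hZ.initial ω
  have hzT : z M.T = 0 := hZ.liquidation ω
  have hp := memLp_exogenousPrice hy i
  -- The term in `a` is added and subtracted, so `a` is free. The player's own permanent impact
  -- γz'(z - x) integrates to γx²/2.
  have hprice : ∀ᵐ t ∂(timeMeasure M.T), rate Z t ω * price M W (Function.update X i Z) t ω =
      M.σ * (deriv z t * W t.toNNReal ω)
        + ((deriv z t * (exogenousPrice M y i t + M.lam * deriv z t) + a / 2 * z t ^ 2)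
          + (-(a / 2) * z t ^ 2 + (M.γ * (deriv z t * z t) + -(M.γ * x) * deriv z t))) := by
    filter_upwards [ae_timeMeasure_mem_Ioo M.T] with t ht
    have htI : t ∈ Icc 0 M.T := ⟨ht.1.le, ht.2.le⟩
    have h0I : (0 : ℝ) ∈ Icc 0 M.T := ⟨le_rfl, hT.le⟩
    have s1 : ∑ j, (Function.update X i Z j t ω - Function.update X i Z j 0 ω) =
        (z t - x) + ∑ j ∈ Finset.univ.erase i, (y j t - y j 0) := by
      rw [← Finset.add_sum_erase _ _ (Finset.mem_univ i)]
      congr 1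
      · rw [Function.update_self, ← hz0]
      · refine Finset.sum_congr rfl fun j hj => ?_
        rw [Function.update_of_ne (Finset.ne_of_mem_erase hj), hX j t htI, hX j 0 h0I]
    have s2 : ∑ j, rate (Function.update X i Z j) t ω =
        deriv z t + ∑ j ∈ Finset.univ.erase i, deriv (y j) t := by
      rw [← Finset.add_sum_erase _ _ (Finset.mem_univ i)]
      congr 1
      · rw [Function.update_self]
        rfl
      · refine Finset.sum_congr rfl fun j hj => ?_
        rw [Function.update_of_ne (Finset.ne_of_mem_erase hj)]
        exact deriv_eq_of_eqOn_Icc (fun s hs => hX j s hs ω) ht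
    unfold price
    rw [s1, s2]
    unfold unaffectedPrice exogenousPrice
    change deriv z t * _ = _
    ring
  have iW : Integrable (fun t => deriv z t * W t.toNNReal ω) (timeMeasure M.T) :=
    hzS.memLp.integrable_mul (memLp_of_continuousOn hω.continuousOn 2)
  have iJ := integrable_pathObjective (lam := M.lam) (a := a) hT hp hzS
  have iQ : Integrable (fun t => -(a / 2) * z t ^ 2) (timeMeasure M.T) :=
    (hzS.memLp_self hT).integrable_sq.const_mul _
  have iZ : Integrable (fun t => M.γ * (deriv z t * z t)) (timeMeasure M.T) :=
    (hzS.memLp.integrable_mul (hzS.memLp_self hT)).const_mul _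
  have iD : Integrable (fun t => -(M.γ * x) * deriv z t) (timeMeasure M.T) :=
    (hzS.memLp.integrable (by norm_num)).const_mul _
  have iZD := iZ.add iD
  have iQZD := iQ.add iZD
  have iall := iJ.add iQZD
  simp only [Pi.add_def] at iZD iQZD iall
  have hD : ∫ t, deriv z t ∂(timeMeasure M.T) = -x := by
    have h := hzS.integral_deriv hT (t := M.T) ⟨hT.le, le_rfl⟩
    rw [hz0, hzT] at h
    rw [integral_timeMeasure hT]
    linarith
  unfold revenues
  rw [← integral_timeMeasure hT, integral_congr_ae hprice, integral_add (iW.const_mul _) iall,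
    integral_add iJ iQZD, integral_add iQ iZD, integral_add iZ iD, integral_const_mul,
    integral_const_mul, integral_const_mul, integral_const_mul, hzS.integral_deriv_mul_self hT,
    hD, hz0, hzT, integral_timeMeasure hT (fun t => deriv z t * W t.toNNReal ω),
    integral_timeMeasure hT (fun t => z t ^ 2)]
  unfold pathIntegral pathObjective
  change _ = M.σ * -(∫ t in (0 : ℝ)..M.T, deriv z t * W t.toNNReal ω) + _ + _
  ring

variable {P : Measure Ω} [IsProbabilityMeasure P]

/-- With weight ασ² the leftover (ασ²/2)∫z² dt is exactly the variance penalty, as the revenues have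
variance σ²∫z² dt. -/
lemma meanVariance_revenues (hW : IsFilteredBrownian F P W) (hy : ∀ j, SobolevPath M.T (y j))
    (hX : ∀ j, ∀ t ∈ Icc 0 M.T, ∀ ω, X j t ω = y j t) {Z : ℝ → Ω → ℝ} {z : ℝ → ℝ}
    (hZ : Admissible F M.T x Z) (hz : ∀ t ∈ Icc 0 M.T, ∀ ω, Z t ω = z t) (α : ℝ) :
    meanVariance P α (revenues M W X i Z) =
      pathObjective M.T M.lam (α * M.σ ^ 2) (exogenousPrice M y i) z - M.γ * x ^ 2 / 2 := by
  have hT := M.T_pos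
  set q := ∫ t in (0 : ℝ)..M.T, z t ^ 2 with hq
  have hqω : ∀ ω, ∫ t in (0 : ℝ)..M.T, Z t ω ^ 2 = q := fun ω => by
    refine intervalIntegral.integral_congr fun t ht => ?_
    rw [uIcc_of_le hT.le] at ht
    simp only [hz t ht ω]
  set k := pathObjective M.T M.lam (α * M.σ ^ 2) (exogenousPrice M y i) z - M.γ * x ^ 2 / 2
  have hR : revenues M W X i Z =ᵐ[P] fun ω => M.σ * pathIntegral M.T W Z ω
      + (k + α * M.σ ^ 2 / 2 * q) := by
    filter_upwards [hW.ae_path] with ω hω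
    rw [revenues_eq hy hX hZ hω.1 (α * M.σ ^ 2), hqω,
      pathObjective_congr (z := z) fun t ht => hz t ht ω, add_assoc]
  obtain ⟨hi, h0⟩ := integral_pathIntegral hT hW hZ
  unfold meanVariance
  rw [integral_congr_ae hR, variance_congr hR, variance_add_const (hi.const_mul _).1,
    variance_const_mul, variance_pathIntegral hT hW hZ hqω,
    integral_add (hi.const_mul _) (integrable_const _), integral_const_mul, h0]
  simp
  ring

end Revenues

/-! ### Expected CARA utility. -/

section Utility

lemma caraUtility_mono {α : ℝ} (hα : 0 ≤ α) : Monotone (caraUtility α) := by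
  intro r s h
  unfold caraUtility
  split_ifs with h0
  · exact h
  · have : Real.exp (-α * s) ≤ Real.exp (-α * r) := Real.exp_le_exp.2 (by nlinarith)
    gcongr

variable {Ω : Type*} [mΩ : MeasurableSpace Ω] {P : Measure Ω}

lemma extExpectation_mono {f g : Ω → ℝ} (h : f ≤ᵐ[P] g) :
    extExpectation P f ≤ extExpectation P g := by
  refine EReal.sub_le_sub (EReal.coe_ennreal_le_coe_ennreal_iff.2 ?_)
    (EReal.coe_ennreal_le_coe_ennreal_iff.2 ?_)
  · refine lintegral_mono_ae ?_
    filter_upwards [h] with ω hω using ENNReal.ofReal_le_ofReal hω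
  · refine lintegral_mono_ae ?_
    filter_upwards [h] with ω hω using ENNReal.ofReal_le_ofReal (neg_le_neg hω)

lemma extExpectation_eq_integral {f : Ω → ℝ} (hf : Integrable f P) :
    extExpectation P f = ((∫ ω, f ω ∂P : ℝ) : EReal) := by
  unfold extExpectation
  rw [integral_eq_lintegral_pos_part_sub_lintegral_neg_part hf, EReal.coe_sub,
    EReal.coe_ennreal_toReal hf.lintegral_lt_top.ne,
    EReal.coe_ennreal_toReal (by simpa using hf.neg.lintegral_lt_top.ne)]

variable [IsProbabilityMeasure P] {F : Filtration ℝ≥0 mΩ} {W : ℝ≥0 → Ω → ℝ}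

/-- The quadratic term compensates the exponential at θ = ασ, so the randomness of `Z` leaves the
expected utility unchanged. For α = 0 only the zero mean of the integral is used. -/
lemma extExpectation_caraUtility {T x σ α k : ℝ} (hT : 0 < T) (hW : IsFilteredBrownian F P W)
    {Z : ℝ → Ω → ℝ} (hZ : Admissible F T x Z) :
    extExpectation P (fun ω => caraUtility α (σ * pathIntegral T W Z ω + k
      + α * σ ^ 2 / 2 * ∫ t in (0 : ℝ)..T, Z t ω ^ 2)) = (caraUtility α k : ℝ) := by
  by_cases hα : α = 0
  · obtain ⟨hi, h0⟩ := integral_pathIntegral hT hW hZ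
    have e : (fun ω => caraUtility α (σ * pathIntegral T W Z ω + k
      + α * σ ^ 2 / 2 * ∫ t in (0 : ℝ)..T, Z t ω ^ 2)) =
        fun ω => σ * pathIntegral T W Z ω + k := by
      ext ω
      simp [caraUtility, hα]
    have hi2 := (hi.const_mul σ).add (integrable_const k)
    simp only [Pi.add_def] at hi2
    rw [e, extExpectation_eq_integral hi2,
      integral_add (hi.const_mul σ) (integrable_const k), integral_const_mul, h0]
    simp [caraUtility, hα]
  · obtain ⟨hi, h1⟩ := integral_exp_pathIntegral hT hW hZ (α * σ)
    set E : Ω → ℝ := fun ω => Real.exp (-(α * σ * pathIntegral T W Z ω)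
      - (α * σ) ^ 2 / 2 * ∫ t in (0 : ℝ)..T, Z t ω ^ 2) with hE
    have e : (fun ω => caraUtility α (σ * pathIntegral T W Z ω + k
      + α * σ ^ 2 / 2 * ∫ t in (0 : ℝ)..T, Z t ω ^ 2)) =
        fun ω => 1 / α * (1 - E ω * Real.exp (-α * k)) := by
      ext ω
      simp only [caraUtility, hα, if_false, hE]
      rw [← Real.exp_add]
      congr 3
      ring
    have hi2 := (integrable_const (μ := P) (1 : ℝ)).sub (hi.mul_const (Real.exp (-α * k)))
    simp only [Pi.sub_def] at hi2
    rw [e, extExpectation_eq_integral (hi2.const_mul (1 / α)), integral_const_mul,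
      integral_sub (integrable_const 1) (hi.mul_const _), integral_mul_const, h1]
    simp [caraUtility, hα]

end Utility

/-! ### From the Euler–Lagrange system to equilibria and back. -/

section Equilibrium

variable {Ω : Type*} [mΩ : MeasurableSpace Ω] {P : Measure Ω} [IsProbabilityMeasure P]
  {F : Filtration ℝ≥0 mΩ} {W : ℝ≥0 → Ω → ℝ} {M : Market} {n : ℕ} {α x : Fin n → ℝ}

lemma IsMeanVarianceNash.weakEulerLagrange (hW : IsFilteredBrownian F P W)
    {Y : Fin n → ℝ → Ω → ℝ} (hY : IsMeanVarianceNash M F P W α x Y) (ω₀ : Ω) :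
    WeakEulerLagrange M α (fun i t => Y i t ω₀) := by
  have hT := M.T_pos
  have hS : ∀ i, SobolevPath M.T (fun t => Y i t ω₀) := fun i => (hY i).1.1.sobolevPath hT ω₀
  have hdet : ∀ j, ∀ t ∈ Icc 0 M.T, ∀ ω, Y j t ω = Y j t ω₀ := fun j t ht ω =>
    (hY j).1.2 t ht ω ω₀
  intro i η hη h0 h1
  refine firstVariation_eq_zero_of_isMax hT (memLp_exogenousPrice hS i) (hS i) hη fun ε => ?_
  have hZ : AdmissibleDet F M.T (x i) (fun t (_ : Ω) => Y i t ω₀ + ε * η t) :=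
    ((hS i).add_const_mul hT hη ε).admissibleDet F hT (by simp [h0, (hY i).1.1.initial])
      (by simp [h1, (hY i).1.1.liquidation])
  have h := (hY i).2 _ hZ
  rw [meanVariance_revenues hW hS hdet hZ.1 (fun _ _ _ => rfl),
    meanVariance_revenues hW hS hdet (hY i).1.1 (hdet i)] at h
  linarith

variable {X : Fin n → ℝ → ℝ}

lemma isMeanVarianceNash_of_weakEulerLagrange (hW : IsFilteredBrownian F P W)
    (hα : ∀ i, 0 ≤ α i) (hS : ∀ i, SobolevPath M.T (X i)) (hX : WeakEulerLagrange M α X)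
    (h0 : ∀ i, X i 0 = x i) (h1 : ∀ i, X i M.T = 0) :
    IsMeanVarianceNash M F P W α x (fun i t _ => X i t) := by
  have hT := M.T_pos
  intro i
  have hXi : AdmissibleDet F M.T (x i) (fun t (_ : Ω) => X i t) :=
    (hS i).admissibleDet F hT (h0 i) (h1 i)
  refine ⟨hXi, fun Y hY => ?_⟩
  obtain ⟨ω₀⟩ : Nonempty Ω := P.nonempty_of_neZero
  rw [meanVariance_revenues hW hS (fun _ _ _ _ => rfl) hXi.1 (z := X i) (fun _ _ _ => rfl),
    meanVariance_revenues hW hS (fun _ _ _ _ => rfl) hY.1 (z := fun t => Y t ω₀)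
      (fun t ht ω => hY.2 t ht ω ω₀)]
  have hle := pathObjective_le_of_firstVariation_eq_zero hT M.lam_pos.le
    (mul_nonneg (hα i) (sq_nonneg M.σ)) (memLp_exogenousPrice hS i) (hS i) (hX i)
    (hY.1.sobolevPath hT ω₀) (by rw [hY.1.initial, h0]) (by rw [hY.1.liquidation, h1])
  linarith

lemma isCaraNash_of_weakEulerLagrange (hW : IsFilteredBrownian F P W)
    (hα : ∀ i, 0 ≤ α i) (hS : ∀ i, SobolevPath M.T (X i)) (hX : WeakEulerLagrange M α X)
    (h0 : ∀ i, X i 0 = x i) (h1 : ∀ i, X i M.T = 0) :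
    IsCaraNash M F P W α x (fun i t _ => X i t) := by
  have hT := M.T_pos
  intro i
  have hXi : Admissible F M.T (x i) (fun t (_ : Ω) => X i t) :=
    ((hS i).admissibleDet F hT (h0 i) (h1 i)).1
  refine ⟨hXi, fun Y hY => ?_⟩
  set k := pathObjective M.T M.lam (α i * M.σ ^ 2) (exogenousPrice M X i) (X i)
    - M.γ * x i ^ 2 / 2 with hk
  -- Each path of a random strategy is itself a deterministic competitor, so `k` bounds its
  -- objective scenario by scenario. Monotonicity of `extExpectation` needs no integrability of the
  -- competitor's utility.
  have hYle : extExpectation P (fun ω => caraUtility (α i)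
      (revenues M W (fun i t _ => X i t) i Y ω)) ≤ (caraUtility (α i) k : ℝ) := by
    rw [← extExpectation_caraUtility (σ := M.σ) hT hW hY]
    refine extExpectation_mono ?_
    filter_upwards [hW.ae_path] with ω hω
    refine caraUtility_mono (hα i) ?_
    rw [revenues_eq hS (fun _ _ _ _ => rfl) hY hω.1 (α i * M.σ ^ 2)]
    have hle := pathObjective_le_of_firstVariation_eq_zero hT M.lam_pos.le
      (mul_nonneg (hα i) (sq_nonneg M.σ)) (memLp_exogenousPrice hS i) (hS i) (hX i)
      (hY.sobolevPath hT ω) (by rw [hY.initial, h0]) (by rw [hY.liquidation, h1])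
    linarith
  refine hYle.trans ?_
  rw [← extExpectation_caraUtility (σ := M.σ) hT hW hXi]
  refine extExpectation_mono ?_
  filter_upwards [hW.ae_path] with ω hω
  rw [revenues_eq hS (fun _ _ _ _ => rfl) hXi hω.1 (α i * M.σ ^ 2)]

end Equilibrium

end MarketImpact

theorem corollary2p3 {Ω : Type*} [mΩ : MeasurableSpace Ω] (P : Measure Ω) [IsProbabilityMeasure P]
    (F : Filtration ℝ≥0 mΩ) (W : ℝ≥0 → Ω → ℝ) (hW : MarketImpact.IsFilteredBrownian F P W)
    (M : MarketImpact.Market) (n : ℕ) (α x : Fin n → ℝ) (hα : ∀ i, 0 ≤ α i) :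
    ∃ X : Fin n → ℝ → ℝ,
      (MarketImpact.SolvesBVP M α x X ∧
        ∀ Y : Fin n → ℝ → ℝ, MarketImpact.SolvesBVP M α x Y →
          ∀ i, ∀ t ∈ Icc 0 M.T, Y i t = X i t) ∧
      (MarketImpact.IsMeanVarianceNash M F P W α x (fun i t _ => X i t) ∧
        ∀ Y : Fin n → ℝ → Ω → ℝ, MarketImpact.IsMeanVarianceNash M F P W α x Y →
          ∀ i, ∀ t ∈ Icc 0 M.T, ∀ ω, Y i t ω = X i t) ∧
      MarketImpact.IsCaraNash M F P W α x (fun i t _ => X i t) := by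
  obtain ⟨X, hX⟩ := MarketImpact.exists_solvesBVP M α x hα
  obtain ⟨hS, hE⟩ := hX.weakEulerLagrange
  have h0 : ∀ i, X i 0 = x i := fun i => (hX.1 i).2.1
  have h1 : ∀ i, X i M.T = 0 := fun i => (hX.1 i).2.2
  refine ⟨X, ⟨hX, fun Y hY i t ht => ?_⟩,
    ⟨MarketImpact.isMeanVarianceNash_of_weakEulerLagrange hW hα hS hE h0 h1,
      fun Y hY i t ht ω => ?_⟩,
    MarketImpact.isCaraNash_of_weakEulerLagrange hW hα hS hE h0 h1⟩
  · obtain ⟨hYS, hYE⟩ := hY.weakEulerLagrange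
    exact hYE.eqOn hα hYS hS hE (fun i => by rw [h0, (hY.1 i).2.1])
      (fun i => by rw [h1, (hY.1 i).2.2]) i ht
  -- Freezing any scenario ω gives a weak solution with the same end points as `X`.
  · exact (hY.weakEulerLagrange hW ω).eqOn hα
      (fun i => (hY i).1.1.sobolevPath M.T_pos ω) hS hE
      (fun i => by rw [h0, (hY i).1.1.initial]) (fun i => by rw [h1, (hY i).1.1.liquidation]) i ht
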